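/- Let $L$ be an even and $N$ an odd natural number, let $q\in\mathbb C$ be a primitive $N$-th root of unity, put $\omega=q^2$, and let $q^{1/2}:=q^{(N+1)/2}$ be the square root of $q$ that is an $N$-th root of unity. Let $V\subset(\mathbb C^2)^{\otimes L}$ be the span of the basis vectors $|\beta_1,\dots,\beta_L\rangle$, $\beta_\ell=\pm1$, with $\sum_\ell\beta_\ell\equiv 0 \pmod N$ (equivalently $S^z=\frac12\sum_\ell\sigma^z_\ell\equiv0\pmod N$). Six-vertex transfer matrix. For $s\ne 0$ and $z=s^2$ let $T(z)=\mathrm{tr}_{aux}\bigotimes_{\ell=1}^L L_\ell(s)$ be restricted to $V$, where $$L(s)=\begin{pmatrix} s\,q^{-\sigma^z/2}-s^{-1}q^{\sigma^z/2} & (q-q^{-1})\sigma_-\\ (q-q^{-1})\sigma_+ & s\,q^{\sigma^z/2}-s^{-1}q^{-\sigma^z/2}\end{pmatrix}$$ (matrix in the auxiliary space $\mathbb C^2$, entries acting on the quantum space $\mathbb C^2$). Let $T^{(2)}(\tilde t)$ be the operator on $V$, polynomial in $\tilde t$, given by $T^{(2)}(\tilde t)=z^{L/2}T(z)$ with $\tilde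 t=qz$. Fusion matrices. Define $T^{(j)}(\tilde t)$, $j\ge0$, on $V$ recursively by $T^{(0)}=0$, $T^{(1)}(\tilde t)=(1-\omega^{-1}\tilde t)^L$ and $$T^{(j)}(\tilde t)\,T^{(2)}(\omega^{j-1}\tilde t)=(1-\omega^{j-1}\tilde t)^L\,T^{(j-1)}(\tilde t)+(1-\omega^{j-2}\tilde t)^L\,T^{(j+1)}(\tilde t),\qquad j\ge1 .$$ The $Q$-operator. For $s\in\mathbb C$ let $Q(s)$ be the operator on $V$ with matrix entries $$\langle\alpha_1,\dots,\alpha_L|Q(s)|\beta_1,\dots,\beta_L\rangle=q^{-\frac12\sum_\ell\alpha_\ell\sum_{m<\ell}\beta_m}\;q^{-\frac14\sum_\ell\alpha_\ell\beta_\ell}\;s^{\frac12\sum_\ell(1-\alpha_\ell\beta_\ell)}$$ (as $L$ is even, the exponents of $q$ are half-integers, and the powers are taken with the above $q^{1/2}$). Theorem. (a) The recursion is solvable in polynomials: all $T^{(j)}(\tilde t)$ have entries polynomial in $\tilde t$, and the displayed fusion relations hold for all $j\ge 1$. (b) For all integers $0\le j\le N$ and all $s\in\mathbb C$, with $\tilde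 t=qs^2$, $$N\,Q(q^{-1}s)\,Q(-q^{j-1}s)=T^{(j)}(\tilde t)+T^{(N-j)}(\omega^j\tilde t).$$ (c) $Q(s)$ is invertible for all but finitely many $s\in\mathbb C$, and for every $s$ such that $Q(q^ks)$ is invertible for $0\le k\le N-1$, with $\tilde t=qs^2$, $$N\,Q(-s)=Q(s)\sum_{k=0}^{N-1}(1-\omega^{k-1}\tilde t)^L\,Q(q^{k-1}s)^{-1}\,Q(q^ks)^{-1}.$$ -/

import Mathlib

namespace SixVertex

open Polynomial

noncomputable section

/-- Basis of the space `V`: spin configurations `β_ℓ = ±1` with `∑ β_ℓ ≡ 0 (mod N)`.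
For even `L` and odd `N` this is the sector `S^z = (1/2) ∑ β_ℓ ≡ 0 (mod N)`. -/
abbrev Sector (L N : ℕ) : Type :=
  {β : Fin L → ℤˣ // (N : ℤ) ∣ ∑ ℓ, (β ℓ : ℤ)}

/-- For odd `N` and `q ^ N = 1`: the square root `q^{1/2}` of `q` that is again an `N`-th root of
unity. -/
def sqrtQ (N : ℕ) (q : ℂ) : ℂ := q ^ ((N + 1) / 2)

/-- `σ_+`, with `σ_+ |-1⟩ = |1⟩`. -/
def sigmaPlus : Matrix ℤˣ ℤˣ ℂ := fun α β => if α = 1 ∧ β = -1 then 1 else 0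

/-- `σ_-`, with `σ_- |1⟩ = |-1⟩`. -/
def sigmaMinus : Matrix ℤˣ ℤˣ ℂ := fun α β => if α = -1 ∧ β = 1 then 1 else 0

/-- `q^{m σ^z / 2}`. -/
def qSigmaZ (N : ℕ) (q : ℂ) (m : ℤ) : Matrix ℤˣ ℤˣ ℂ :=
  Matrix.diagonal fun α => sqrtQ N q ^ (m * (α : ℤ))

/-- The six-vertex `L`-operator at `s = z^{1/2}`: a `2 × 2` matrix (auxiliary space) of operators on
the quantum space `ℂ²` with basis `|±1⟩`. -/
def Lop (N : ℕ) (q s : ℂ) : Matrix (Fin 2) (Fin 2) (Matrix ℤˣ ℤˣ ℂ) :=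
  !![s • qSigmaZ N q (-1) - s⁻¹ • qSigmaZ N q 1, (q - q⁻¹) • sigmaMinus;
     (q - q⁻¹) • sigmaPlus, s • qSigmaZ N q 1 - s⁻¹ • qSigmaZ N q (-1)]

/-- The transfer matrix `T(z) = tr_aux ⨂_ℓ L_ℓ(s)`, `z = s²`, as an operator of `V`: the entry
`⟨α| T |β⟩` is the trace of the ordered product of the auxiliary `2 × 2` matrices
`⟨α_ℓ| L(s) |β_ℓ⟩`. (`T(z)` preserves `S^z`, so it preserves `V`.) -/
def transfer (L N : ℕ) (q s : ℂ) : Matrix (Sector L N) (Sector L N) ℂ := fun α β =>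
  Matrix.trace (List.ofFn fun ℓ : Fin L =>
    (Matrix.of fun i j => Lop N q s i j (α.1 ℓ) (β.1 ℓ) : Matrix (Fin 2) (Fin 2) ℂ)).prod

/-- The matrix `⟨α| s L(s) |β⟩`, conjugated by `diag(1, s)` in the auxiliary space so that its
entries are polynomials in `t = q z = q s²` (the polynomial variable is `t`). The trace of the
monodromy is unaffected; see `transferPoly_eval`. -/
def localPoly (N : ℕ) (q : ℂ) (α β : ℤˣ) : Matrix (Fin 2) (Fin 2) ℂ[X] :=
  !![C (q⁻¹ * qSigmaZ N q (-1) α β) * X - C (qSigmaZ N q 1 α β),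
      C (q⁻¹ * ((q - q⁻¹) * sigmaMinus α β)) * X;
     C ((q - q⁻¹) * sigmaPlus α β),
      C (q⁻¹ * qSigmaZ N q 1 α β) * X - C (qSigmaZ N q (-1) α β)]

/-- `T^{(2)}(t) = z^{L/2} T(z)`, `t = q z`, as a matrix with entries polynomial in `t`; by
`transferPoly_eval` it is the only one with `T^{(2)}(q s²) = s^L T(s²)`. -/
def transferPoly (L N : ℕ) (q : ℂ) : Matrix (Sector L N) (Sector L N) ℂ[X] := fun α β =>
  Matrix.trace (List.ofFn fun ℓ : Fin L => localPoly N q (α.1 ℓ) (β.1 ℓ)).prod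

/-- `H(c t)^L = (1 - c t)^L` as a polynomial in `t`. -/
def hPow (L : ℕ) (c : ℂ) : ℂ[X] := (1 - C c * X) ^ L

/-- `M(t) ↦ M(c t)` for a matrix polynomial `M`. -/
def rescale {ι : Type} (c : ℂ) (M : Matrix ι ι ℂ[X]) : Matrix ι ι ℂ[X] :=
  M.map fun p => p.comp (C c * X)

/-- `M(t₀)` for a matrix polynomial `M`. -/
def evalAt {ι : Type} (t₀ : ℂ) (M : Matrix ι ι ℂ[X]) : Matrix ι ι ℂ :=
  M.map fun p => p.eval t₀

/-- The fusion matrices, with `ω = q²`: `T^{(0)} = 0`, `T^{(1)}(t) = (1 - ω⁻¹ t)^L`, and `T^{(j+1)}`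
obtained from the fusion relation
`T^{(j)}(t) T^{(2)}(ω^{j-1} t) = (1 - ω^{j-1} t)^L T^{(j-1)}(t) + (1 - ω^{j-2} t)^L T^{(j+1)}(t)`,
`j ≥ 1`, by entrywise division of polynomials in `t`. -/
def fusion (L N : ℕ) (q : ℂ) : ℕ → Matrix (Sector L N) (Sector L N) ℂ[X]
  | 0 => 0
  | 1 => hPow L (q ^ 2)⁻¹ • (1 : Matrix (Sector L N) (Sector L N) ℂ[X])
  | (j + 2) => (fusion L N q (j + 1) * rescale ((q ^ 2) ^ j) (transferPoly L N q)
        - hPow L ((q ^ 2) ^ j) • fusion L N q j).map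
      fun p => p / hPow L ((q ^ 2) ^ ((j : ℤ) - 1))

/-- The explicit operator `Q(s)` of `V`, with entries
`q^{-(1/2) ∑_ℓ α_ℓ ∑_{m < ℓ} β_m} q^{-(1/4) ∑_ℓ α_ℓ β_ℓ} s^{∑_ℓ (1 - α_ℓ β_ℓ) / 2}`.
The last exponent counts the sites with `α_ℓ ≠ β_ℓ`, and `∑_ℓ α_ℓ β_ℓ` is even for even `L`, so
every power of `q` is a power of `q^{1/2}`. -/
def Qop (L N : ℕ) (q s : ℂ) : Matrix (Sector L N) (Sector L N) ℂ := fun α β =>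
  sqrtQ N q ^ (-∑ ℓ, (α.1 ℓ : ℤ) * ∑ m ∈ Finset.univ.filter (fun m => m < ℓ), (β.1 m : ℤ))
    * sqrtQ N q ^ (-((∑ ℓ, (α.1 ℓ : ℤ) * (β.1 ℓ : ℤ)) / 2))
    * s ^ (Finset.univ.filter fun ℓ => α.1 ℓ ≠ β.1 ℓ).card

theorem localPoly_eval (N : ℕ) {q s : ℂ} (hq : q ≠ 0) (hs : s ≠ 0) (α β : ℤˣ) :
    (localPoly N q α β).map (Polynomial.evalRingHom (q * s ^ 2)) =
      s • (!![1, 0; 0, s⁻¹] * (Matrix.of fun i j => Lop N q s i j α β) * !![1, 0; 0, s]) := by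
  have h : (Matrix.of fun i j => Lop N q s i j α β : Matrix (Fin 2) (Fin 2) ℂ) =
      !![s * qSigmaZ N q (-1) α β - s⁻¹ * qSigmaZ N q 1 α β, (q - q⁻¹) * sigmaMinus α β;
         (q - q⁻¹) * sigmaPlus α β, s * qSigmaZ N q 1 α β - s⁻¹ * qSigmaZ N q (-1) α β] := by
    ext i j
    fin_cases i <;> fin_cases j <;> rfl
  rw [h]
  ext i j
  fin_cases i <;> fin_cases j <;> simp [localPoly] <;> field_simp

theorem transferPoly_eval (L N : ℕ) {q s : ℂ} (hq : q ≠ 0) (hs : s ≠ 0) :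
    evalAt (q * s ^ 2) (transferPoly L N q) = s ^ L • transfer L N q s := by
  have hD : (!![1, 0; 0, s] : Matrix (Fin 2) (Fin 2) ℂ) * !![1, 0; 0, s⁻¹] = 1 := by
    ext i j
    fin_cases i <;> fin_cases j <;> simp [Matrix.mul_apply, Fin.sum_univ_two, hs]
  have hD' : (!![1, 0; 0, s⁻¹] : Matrix (Fin 2) (Fin 2) ℂ) * !![1, 0; 0, s] = 1 := by
    ext i j
    fin_cases i <;> fin_cases j <;> simp [Matrix.mul_apply, Fin.sum_univ_two, hs]
  ext α β
  have key : ∀ l : List (Fin L),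
      ((l.map fun ℓ => localPoly N q (α.1 ℓ) (β.1 ℓ)).prod).map
          (Polynomial.evalRingHom (q * s ^ 2)) =
        s ^ l.length • (!![1, 0; 0, s⁻¹] *
          (l.map fun ℓ => (Matrix.of fun i j => Lop N q s i j (α.1 ℓ) (β.1 ℓ) :
            Matrix (Fin 2) (Fin 2) ℂ)).prod * !![1, 0; 0, s]) := by
    intro l
    induction l with
    | nil => simpa using hD'.symm
    | cons a l ih =>
      rw [List.map_cons, List.prod_cons, Matrix.map_mul, ih, localPoly_eval N hq hs,
        List.map_cons, List.prod_cons, List.length_cons, pow_succ', smul_mul_smul_comm]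
      congr 1
      generalize (Matrix.of fun i j => Lop N q s i j (α.1 a) (β.1 a) :
        Matrix (Fin 2) (Fin 2) ℂ) = A
      generalize (l.map fun ℓ => (Matrix.of fun i j => Lop N q s i j (α.1 ℓ) (β.1 ℓ) :
        Matrix (Fin 2) (Fin 2) ℂ)).prod = B
      calc !![1, 0; 0, s⁻¹] * A * !![1, 0; 0, s] * (!![1, 0; 0, s⁻¹] * B * !![1, 0; 0, s])
          = !![1, 0; 0, s⁻¹] * A * (!![1, 0; 0, s] * !![1, 0; 0, s⁻¹]) * B * !![1, 0; 0, s] := by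
            simp only [mul_assoc]
        _ = _ := by rw [hD]; simp only [mul_assoc, one_mul]
  have h := key (List.finRange L)
  rw [List.length_finRange] at h
  have h2 := congrArg Matrix.trace h
  rw [Matrix.trace_smul, Matrix.trace_mul_comm, ← mul_assoc, hD, one_mul,
    ← AddMonoidHom.map_trace (Polynomial.evalRingHom (q * s ^ 2))] at h2
  simpa [evalAt, transferPoly, transfer, List.ofFn_eq_map] using h2

end

end SixVertex

/-! Spin conservation turns every operator into a sum over heights: an integer height moves by half
the spin difference at each site, and a matrix entry is a sum over starting heights of products of
local weights (`pathProd`). The weight of a closed path depends only on its flat weights and on the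
product of the up and down weights of each edge, so weights may be changed by a gauge.

Fusion: `fusionWeight` vanishes on the upward edge into height 0 and on the downward edge out of
height `j`, so closed paths starting in `[0, j)` stay there, and their sum is the trace of a
`j`-dimensional auxiliary space. Tensoring with the two-dimensional space gives, at each total
height, a `2 × 2` matrix with an invariant line and a covector annihilating it. The line carries the
weights for `j - 1`, the quotient those for `j + 1`; this is the fusion relation, and it shows that
the recursive divisions are exact.

QQ-relations: the sector condition on the intermediate configuration of `Q(a) Q(b)` is a Fourier sum
over `N` cyclic heights, and the product factorizes over sites. When `b = -q^j a`, one-way barriers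
cut the cycle into blocks of `j` and `N - j` heights, gauge equivalent to the fusion weights for `j`
and, at the spectral parameter multiplied by `ω^j`, for `N - j`.

Functional relation: the QQ-relations give enough commutativity and, with the fusion relation, a
TQ-relation for generic `s`. A discrete Wronskian identity follows and extends to all `s` by
continuity. Dividing it by two neighbouring `Q`s makes it telescope, up to `T^{(N)}(ω t) = N Q(-s)
Q(s)`. -/

namespace SixVertex

/-! ### Height paths, one-way barriers and gauge invariance -/

/-- Half the difference of two spins. -/
def step (a b : ℤˣ) : ℤ := if a = b then 0 else (a : ℤ)

theorem two_mul_step (a b : ℤˣ) : 2 * step a b = (a : ℤ) - b := by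
  revert a b; decide

theorem step_add_step (a b c : ℤˣ) : step a b + step b c = step a c := by
  revert a b c; decide

/-- Half the difference of the total spins of two configurations. -/
def disp {L : ℕ} (α β : Fin L → ℤˣ) : ℤ := ∑ l, step (α l) (β l)

theorem two_mul_disp {L : ℕ} (α β : Fin L → ℤˣ) :
    2 * disp α β = ∑ l, (α l : ℤ) - ∑ l, (β l : ℤ) := by
  simp only [disp, Finset.mul_sum, two_mul_step, Finset.sum_sub_distrib]

theorem disp_add_disp {L : ℕ} (α β γ : Fin L → ℤˣ) : disp α β + disp β γ = disp α γ := by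
  simp only [disp, ← Finset.sum_add_distrib, step_add_step]

theorem disp_succ {L : ℕ} (α β : Fin (L + 1) → ℤˣ) :
    disp α β = step (α 0) (β 0) + disp (Fin.tail α) (Fin.tail β) := by
  simp only [disp, Fin.sum_univ_succ, Fin.tail]

/-- The ordered product of the weights `w n (α l) (β l)` along the path that starts at the height
`n` and moves by `step (α l) (β l)` at the site `l`. -/
def pathProd {R : Type*} [Monoid R] (w : ℤ → ℤˣ → ℤˣ → R) :
    (L : ℕ) → ℤ → (Fin L → ℤˣ) → (Fin L → ℤˣ) → R
  | 0, _, _, _ => 1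
  | L + 1, n, α, β => w n (α 0) (β 0) *
      pathProd w L (n + step (α 0) (β 0)) (Fin.tail α) (Fin.tail β)

theorem map_pathProd {R S : Type*} [Monoid R] [Monoid S] (f : R →* S) (w : ℤ → ℤˣ → ℤˣ → R)
    (L : ℕ) (n : ℤ) (α β : Fin L → ℤˣ) :
    f (pathProd w L n α β) = pathProd (fun n a b => f (w n a b)) L n α β := by
  induction L generalizing n with
  | zero => simp [pathProd]
  | succ L ih => simp only [pathProd, map_mul, ih]

theorem pathProd_mul_shift {R : Type*} [CommMonoid R] (c : R) (k : ℤ) (w : ℤ → ℤˣ → ℤˣ → R)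
    (L : ℕ) (n : ℤ) (α β : Fin L → ℤˣ) :
    pathProd (fun n a b => c * w (n + k) a b) L n α β = c ^ L * pathProd w L (n + k) α β := by
  induction L generalizing n with
  | zero => simp [pathProd]
  | succ L ih =>
    simp only [pathProd, ih]
    rw [pow_succ', mul_mul_mul_comm, add_right_comm]

theorem pathProd_eq_ofFn {R : Type*} [Monoid R] (w : ℤˣ → ℤˣ → R)
    (L : ℕ) (n : ℤ) (α β : Fin L → ℤˣ) :
    pathProd (fun _ => w) L n α β = (List.ofFn fun l => w (α l) (β l)).prod := by
  induction L generalizing n with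
  | zero => simp [pathProd]
  | succ L ih => simp [pathProd, ih, List.ofFn_succ, Fin.tail]

theorem pathProd_eq_prod {R : Type*} [CommMonoid R] (w : ℤ → ℤˣ → ℤˣ → R)
    (L : ℕ) (n : ℤ) (α β : Fin L → ℤˣ) :
    pathProd w L n α β =
      ∏ l, w (n + ∑ m ∈ Finset.univ.filter (fun m => m < l), step (α m) (β m)) (α l) (β l) := by
  induction L generalizing n with
  | zero => simp [pathProd]
  | succ L ih =>
    rw [pathProd, ih, Fin.prod_univ_succ]
    congr 1
    · simp
    · refine Finset.prod_congr rfl fun l _ => ?_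
      congr 1
      simp only [Finset.sum_filter, Fin.sum_univ_succ, Fin.tail, Fin.succ_lt_succ_iff,
        Fin.succ_pos, if_true, add_assoc]

theorem step_cases (a b : ℤˣ) :
    step a b = 0 ∨ (a = 1 ∧ b = -1 ∧ step a b = 1) ∨ (a = -1 ∧ b = 1 ∧ step a b = -1) := by
  revert a b; decide

theorem eq_of_step_eq_zero {a b : ℤˣ} : step a b = 0 → a = b := by
  revert a b; decide

/-- Heights move by at most one, so a path from below `c` to `c` or above must climb the edge from
`c - 1` to `c`; a zero weight there is a one-way barrier. -/
theorem pathProd_eq_zero_of_lt_of_le {R : Type*} [MonoidWithZero R] {w : ℤ → ℤˣ → ℤˣ → R} {c : ℤ}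
    (hw : w (c - 1) 1 (-1) = 0) {L : ℕ} {n : ℤ} {α β : Fin L → ℤˣ} (h1 : n < c)
    (h2 : c ≤ n + disp α β) : pathProd w L n α β = 0 := by
  induction L generalizing n with
  | zero => simp [disp] at h2; omega
  | succ L ih =>
    rw [disp_succ, ← add_assoc] at h2
    rw [pathProd]
    by_cases h : n + step (α 0) (β 0) < c
    · rw [ih h h2, mul_zero]
    · rcases step_cases (α 0) (β 0) with h0 | ⟨ha, hb, h0⟩ | ⟨_, _, h0⟩
      · omega
      · rw [ha, hb, show n = c - 1 by omega, hw, zero_mul]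
      · omega

theorem pathProd_eq_zero_of_le_of_lt {R : Type*} [MonoidWithZero R] {w : ℤ → ℤˣ → ℤˣ → R} {c : ℤ}
    (hw : w c (-1) 1 = 0) {L : ℕ} {n : ℤ} {α β : Fin L → ℤˣ} (h1 : c ≤ n)
    (h2 : n + disp α β < c) : pathProd w L n α β = 0 := by
  induction L generalizing n with
  | zero => simp [disp] at h2; omega
  | succ L ih =>
    rw [disp_succ, ← add_assoc] at h2
    rw [pathProd]
    by_cases h : c ≤ n + step (α 0) (β 0)
    · rw [ih h h2, mul_zero]
    · rcases step_cases (α 0) (β 0) with h0 | ⟨_, _, h0⟩ | ⟨ha, hb, h0⟩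
      · omega
      · omega
      · rw [ha, hb, show n = c by omega, hw, zero_mul]

/-- The product of the edge weights along the monotone path from `n` to `n + d`. -/
def edgeProd {R : Type*} [CommMonoid R] (U D : ℤ → R) (n d : ℤ) : R :=
  (∏ i ∈ Finset.range d.toNat, U (n + i)) * ∏ i ∈ Finset.range (-d).toNat, D (n - i)

theorem edgeProd_zero {R : Type*} [CommMonoid R] (U D : ℤ → R) (n : ℤ) :
    edgeProd U D n 0 = 1 := by simp [edgeProd]

theorem edgeProd_of_pos {R : Type*} [CommMonoid R] (U D : ℤ → R) (n : ℤ) {d : ℤ} (hd : 0 < d) :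
    edgeProd U D n d = U n * edgeProd U D (n + 1) (d - 1) := by
  obtain ⟨k, rfl⟩ : ∃ k : ℕ, d = k + 1 := ⟨(d - 1).toNat, by omega⟩
  have h1 : ((k : ℤ) + 1).toNat = k + 1 := by omega
  have h2 : (-((k : ℤ) + 1)).toNat = 0 := by omega
  have h3 : ((k : ℤ) + 1 - 1).toNat = k := by omega
  have h4 : (-((k : ℤ) + 1 - 1)).toNat = 0 := by omega
  simp only [edgeProd, h1, h2, h3, h4, Finset.prod_range_succ', Finset.prod_range_zero, mul_one]
  rw [mul_comm]
  simp [add_left_comm, add_comm]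

theorem edgeProd_of_neg {R : Type*} [CommMonoid R] (U D : ℤ → R) (n : ℤ) {d : ℤ} (hd : d < 0) :
    edgeProd U D n d = D n * edgeProd U D (n - 1) (d + 1) := by
  obtain ⟨k, rfl⟩ : ∃ k : ℕ, d = -(k + 1) := ⟨(-d - 1).toNat, by omega⟩
  have h1 : (-((k : ℤ) + 1)).toNat = 0 := by omega
  have h2 : (-(-((k : ℤ) + 1))).toNat = k + 1 := by omega
  have h3 : (-((k : ℤ) + 1) + 1).toNat = 0 := by omega
  have h4 : (-(-((k : ℤ) + 1) + 1)).toNat = k := by omega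
  simp only [edgeProd, h1, h2, h3, h4, Finset.prod_range_succ', Finset.prod_range_zero, one_mul]
  rw [mul_comm]
  simp [sub_sub, add_comm]

/-- The heights form a line, so the edges of a path cancel in up/down pairs except for those of the
monotone path between its ends. The cofactor `x` collects flat weights and edge pairs, hence is
common to both weights. No division occurs, so weights may vanish. -/
theorem exists_pathProd_eq_mul_edgeProd {R : Type*} [CommMonoid R] {w w' : ℤ → ℤˣ → ℤˣ → R}
    (hd : ∀ n a, w n a a = w' n a a)
    (he : ∀ n, w n 1 (-1) * w (n + 1) (-1) 1 = w' n 1 (-1) * w' (n + 1) (-1) 1)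
    (L : ℕ) (n : ℤ) (α β : Fin L → ℤˣ) :
    ∃ x, pathProd w L n α β =
        x * edgeProd (fun n => w n 1 (-1)) (fun n => w n (-1) 1) n (disp α β) ∧
      pathProd w' L n α β =
        x * edgeProd (fun n => w' n 1 (-1)) (fun n => w' n (-1) 1) n (disp α β) := by
  induction L generalizing n with
  | zero => exact ⟨1, by simp [pathProd, disp, edgeProd_zero]⟩
  | succ L ih =>
    obtain ⟨x, h1, h2⟩ := ih (n + step (α 0) (β 0)) (Fin.tail α) (Fin.tail β)
    have h3 := disp_succ α β
    simp only [pathProd, h1, h2]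
    generalize disp α β = d at *
    generalize disp (Fin.tail α) (Fin.tail β) = d' at *
    rcases step_cases (α 0) (β 0) with h0 | ⟨ha, hb, h0⟩ | ⟨ha, hb, h0⟩
    · rw [h0, zero_add] at h3
      subst h3
      refine ⟨w n (α 0) (β 0) * x, ?_, ?_⟩
      · rw [h0, add_zero, mul_assoc]
      · rw [h0, add_zero, mul_assoc, eq_of_step_eq_zero h0, hd]
    · rw [h0, ha, hb]
      obtain rfl : d' = d - 1 := by omega
      rcases lt_or_ge 0 d with h | h
      · refine ⟨x, ?_, ?_⟩ <;> rw [edgeProd_of_pos _ _ n h, mul_left_comm]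
      -- The remaining monotone path starts by descending the edge just climbed; this pair of
      -- weights moves into the common factor.
      · refine ⟨w n 1 (-1) * w (n + 1) (-1) 1 * x, ?_, ?_⟩
        · rw [edgeProd_of_neg _ _ (n + 1) (by omega : d - 1 < 0)]
          simp only [add_sub_cancel_right, sub_add_cancel]
          ac_rfl
        · rw [edgeProd_of_neg _ _ (n + 1) (by omega : d - 1 < 0), he]
          simp only [add_sub_cancel_right, sub_add_cancel]
          ac_rfl
    · rw [h0, ha, hb, ← sub_eq_add_neg]
      obtain rfl : d' = d + 1 := by omega
      have he' := he (n - 1)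
      rw [sub_add_cancel] at he'
      rcases lt_or_ge d 0 with h | h
      · refine ⟨x, ?_, ?_⟩ <;> rw [edgeProd_of_neg _ _ n h, mul_left_comm]
      · refine ⟨w (n - 1) 1 (-1) * w n (-1) 1 * x, ?_, ?_⟩
        · rw [edgeProd_of_pos _ _ (n - 1) (by omega : 0 < d + 1)]
          simp only [add_sub_cancel_right, sub_add_cancel]
          ac_rfl
        · rw [edgeProd_of_pos _ _ (n - 1) (by omega : 0 < d + 1), he']
          simp only [add_sub_cancel_right, sub_add_cancel]
          ac_rfl

/-- The weight of a closed path depends only on the weights of the flat steps and on the products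
of the two weights of each edge. -/
theorem pathProd_congr_of_disp_eq_zero {R : Type*} [CommMonoid R] {w w' : ℤ → ℤˣ → ℤˣ → R}
    (hd : ∀ n a, w n a a = w' n a a)
    (he : ∀ n, w n 1 (-1) * w (n + 1) (-1) 1 = w' n 1 (-1) * w' (n + 1) (-1) 1)
    {L : ℕ} (n : ℤ) {α β : Fin L → ℤˣ} (h : disp α β = 0) :
    pathProd w L n α β = pathProd w' L n α β := by
  obtain ⟨x, h1, h2⟩ := exists_pathProd_eq_mul_edgeProd hd he L n α β
  rw [h1, h2, h, edgeProd_zero, edgeProd_zero]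

/-! ### Composition with the two-dimensional auxiliary space -/

theorem sum_fin_succ_configurations {R : Type*} [AddCommMonoid R] {L : ℕ}
    (f : (Fin (L + 1) → ℤˣ) → R) :
    ∑ γ, f γ = ∑ a : ℤˣ, ∑ γ : Fin L → ℤˣ, f (Fin.cons a γ) := by
  rw [← (Fin.consEquiv fun _ => ℤˣ).sum_comp, Fintype.sum_prod_type]
  rfl

/-- The composition of a scalar path weight with a matrix product operator with the two-dimensional
auxiliary space. -/
def fuseWeight {R : Type*} [CommSemiring R] (w : ℤ → ℤˣ → ℤˣ → R)
    (B : ℤˣ → ℤˣ → Matrix (Fin 2) (Fin 2) R) (r : ℤ) (a b : ℤˣ) : Matrix (Fin 2) (Fin 2) R :=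
  fun i k => ∑ c, w (r - 1 + (i : ℕ)) a c * B c b i k

/-- By conservation in each factor, the height of the first minus the index `i` of the second equals
`r - 1`, and it moves by the outer step `step a b` whatever the intermediate spin. So `r` is the
height of the composite, and only the index `i` is left as auxiliary space. -/
theorem sum_pathProd_mul_pathProd {R : Type*} [CommSemiring R] (w : ℤ → ℤˣ → ℤˣ → R)
    (B : ℤˣ → ℤˣ → Matrix (Fin 2) (Fin 2) R)
    (hB : ∀ a b (i k : Fin 2), ((k : ℕ) : ℤ) + step a b ≠ (i : ℕ) → B a b i k = 0)
    (L : ℕ) (r n : ℤ) (α β : Fin L → ℤˣ) (i k : Fin 2) :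
    ∑ γ, pathProd w L (r - 1 + (i : ℕ)) α γ * pathProd (fun _ => B) L n γ β i k =
      pathProd (fuseWeight w B) L r α β i k := by
  induction L generalizing r n i with
  | zero => simp [pathProd]
  | succ L ih =>
    rw [sum_fin_succ_configurations]
    simp only [pathProd, Fin.cons_zero, Fin.tail_cons, Matrix.mul_apply]
    have : ∀ (x : Fin 2) (c : ℤˣ), ∑ γ, w (r - 1 + (i : ℕ)) (α 0) c *
        pathProd w L (r - 1 + (i : ℕ) + step (α 0) c) (Fin.tail α) γ *
        (B c (β 0) i x * pathProd (fun _ => B) L (n + step c (β 0)) γ (Fin.tail β) x k) =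
        w (r - 1 + (i : ℕ)) (α 0) c * B c (β 0) i x *
          pathProd (fuseWeight w B) L (r + step (α 0) (β 0)) (Fin.tail α) (Fin.tail β) x k := by
      intro x c
      by_cases h : ((x : ℕ) : ℤ) + step c (β 0) = (i : ℕ)
      · rw [← ih _ (n + step c (β 0)), Finset.mul_sum]
        refine Finset.sum_congr rfl fun γ _ => ?_
        have : r - 1 + (i : ℕ) + step (α 0) c = r + step (α 0) (β 0) - 1 + (x : ℕ) := by
          rw [← step_add_step (α 0) c (β 0)]; omega
        rw [this]
        ring
      · simp [hB _ _ _ _ h]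
    simp only [Finset.mul_sum]
    rw [Finset.sum_congr rfl fun c _ => Finset.sum_comm, Finset.sum_comm]
    refine Finset.sum_congr rfl fun x _ => ?_
    rw [Finset.sum_congr rfl fun c _ => this x c, ← Finset.sum_mul]
    rfl

theorem pathProd_apply_eq_zero {R : Type*} [CommSemiring R]
    (B : ℤˣ → ℤˣ → Matrix (Fin 2) (Fin 2) R)
    (hB : ∀ a b (i k : Fin 2), ((k : ℕ) : ℤ) + step a b ≠ (i : ℕ) → B a b i k = 0)
    {L : ℕ} (n : ℤ) {α β : Fin L → ℤˣ} {i k : Fin 2}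
    (h : ((k : ℕ) : ℤ) + disp α β ≠ (i : ℕ)) :
    pathProd (fun _ => B) L n α β i k = 0 := by
  induction L generalizing n i with
  | zero =>
    have : i ≠ k := by rintro rfl; simp [disp] at h
    simp [pathProd, this]
  | succ L ih =>
    rw [pathProd, Matrix.mul_apply]
    refine Finset.sum_eq_zero fun x _ => ?_
    by_cases h1 : ((x : ℕ) : ℤ) + step (α 0) (β 0) = (i : ℕ)
    · rw [ih, mul_zero]
      rw [disp_succ] at h
      omega
    · rw [hB _ _ _ _ h1, zero_mul]

/-- Local intertwining relations telescope along the path, and a family of height-dependent vectors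
becomes an eigenvector when the path is closed. -/
theorem pathProd_mulVec {R : Type*} [CommSemiring R] {M : ℤ → ℤˣ → ℤˣ → Matrix (Fin 2) (Fin 2) R}
    {v : ℤ → Fin 2 → R} {a : ℤ → ℤˣ → ℤˣ → R}
    (h : ∀ r x y, (M r x y).mulVec (v (r + step x y)) = a r x y • v r)
    (L : ℕ) (r : ℤ) (α β : Fin L → ℤˣ) :
    (pathProd M L r α β).mulVec (v (r + disp α β)) = pathProd a L r α β • v r := by
  induction L generalizing r with
  | zero => simp [pathProd, disp]
  | succ L ih =>
    rw [pathProd, pathProd, disp_succ, ← add_assoc, ← Matrix.mulVec_mulVec, ih, Matrix.mulVec_smul,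
      h, smul_smul, mul_comm]

theorem vecMul_pathProd {R : Type*} [CommSemiring R] {M : ℤ → ℤˣ → ℤˣ → Matrix (Fin 2) (Fin 2) R}
    {v : ℤ → Fin 2 → R} {a : ℤ → ℤˣ → ℤˣ → R}
    (h : ∀ r x y, Matrix.vecMul (v r) (M r x y) = a r x y • v (r + step x y))
    (L : ℕ) (r : ℤ) (α β : Fin L → ℤˣ) :
    Matrix.vecMul (v r) (pathProd M L r α β) = pathProd a L r α β • v (r + disp α β) := by
  induction L generalizing r with
  | zero => simp [pathProd, disp]
  | succ L ih =>
    rw [pathProd, pathProd, disp_succ, ← add_assoc, ← Matrix.vecMul_vecMul, h, Matrix.smul_vecMul,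
      ih, smul_smul]

/-! ### The explicit fusion weights and their fusion relation -/

open Polynomial
noncomputable section

/-- The local weight of the `j`-dimensional auxiliary representation at the spectral parameter `t`,
where `p` is the square root of `q`; its trace over heights `0 ≤ n < j` is the `j`-th fusion
matrix. -/
def fusionWeight (p t : ℂ) (j n : ℤ) (a b : ℤˣ) : ℂ :=
  if a = 1 then
    if b = 1 then p ^ (2 * n - j + 1) * (1 - p ^ (4 * j - 8 - 4 * n) * t)
    else p ^ (-j) * (1 - p ^ (4 * n + 4))
  else
    if b = 1 then p ^ (j - 6) * (1 - p ^ (4 * j - 4 * n)) * t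
    else p ^ (j - 1 - 2 * n) * (1 - p ^ (4 * n - 4) * t)

/-- `fusionWeight` as a polynomial in the spectral parameter. -/
def fusionWeightPoly (p : ℂ) (j n : ℤ) (a b : ℤˣ) : ℂ[X] :=
  if a = 1 then
    if b = 1 then C (p ^ (2 * n - j + 1)) * (1 - C (p ^ (4 * j - 8 - 4 * n)) * X)
    else C (p ^ (-j) * (1 - p ^ (4 * n + 4)))
  else
    if b = 1 then C (p ^ (j - 6) * (1 - p ^ (4 * j - 4 * n))) * X
    else C (p ^ (j - 1 - 2 * n)) * (1 - C (p ^ (4 * n - 4)) * X)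

theorem eval_fusionWeightPoly (p t : ℂ) (j n : ℤ) (a b : ℤˣ) :
    (fusionWeightPoly p j n a b).eval t = fusionWeight p t j n a b := by
  unfold fusionWeightPoly fusionWeight
  split_ifs <;> simp

/-- This zero and the next make `[0, j)` impossible to re-enter, so the sum over `0 ≤ n < j` in
`fusionTrace` needs no truncation of the paths. -/
theorem fusionWeight_up (p t : ℂ) (j : ℤ) : fusionWeight p t j (-1) 1 (-1) = 0 := by
  simp [fusionWeight]

theorem fusionWeight_down (p t : ℂ) (j : ℤ) : fusionWeight p t j j (-1) 1 = 0 := by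
  simp [fusionWeight]

/-- The trace over the `j`-dimensional auxiliary representation, an entry at a time. -/
def fusionTrace {L : ℕ} (p t : ℂ) (j : ℕ) (α β : Fin L → ℤˣ) : ℂ :=
  if disp α β = 0 then ∑ n ∈ Finset.range j, pathProd (fusionWeight p t j) L n α β else 0

/-- `fusionTrace` as a matrix with entries polynomial in the spectral parameter. -/
def fusionTracePoly (L N : ℕ) (p : ℂ) (j : ℕ) : Matrix (Sector L N) (Sector L N) ℂ[X] :=
  fun α β => if disp α.1 β.1 = 0 then
    ∑ n ∈ Finset.range j, pathProd (fusionWeightPoly p j) L n α.1 β.1 else 0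

theorem eval_fusionTracePoly (L N : ℕ) (p t : ℂ) (j : ℕ) (α β : Sector L N) :
    (fusionTracePoly L N p j α β).eval t = fusionTrace p t j α.1 β.1 := by
  unfold fusionTracePoly fusionTrace
  split_ifs
  · rw [eval_finsetSum]
    refine Finset.sum_congr rfl fun n _ => ?_
    have := map_pathProd (Polynomial.evalRingHom t : ℂ[X] →* ℂ) (fusionWeightPoly p j) L n α.1 β.1
    simpa [eval_fusionWeightPoly] using this
  · simp

/-- For `j = 1` the two barriers isolate the single height 0, so only flat steps survive; there both
spins have weight `1 - p⁻⁴ t`. -/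
theorem pathProd_fusionWeight_one (p t : ℂ) {L : ℕ} (α β : Fin L → ℤˣ)
    (h : disp α β = 0) :
    pathProd (fusionWeight p t 1) L 0 α β = if α = β then (1 - p ^ (-4 : ℤ) * t) ^ L else 0 := by
  induction L with
  | zero => simp [pathProd, Subsingleton.elim α β]
  | succ L ih =>
    rw [disp_succ] at h
    rw [pathProd]
    rcases step_cases (α 0) (β 0) with h0 | ⟨ha, hb, h0⟩ | ⟨ha, hb, h0⟩
    · rw [h0, zero_add] at h
      rw [h0, zero_add, ih _ _ h]
      have h1 : α = β ↔ Fin.tail α = Fin.tail β := by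
        constructor
        · rintro rfl; rfl
        · intro h2
          rw [← Fin.cons_self_tail α, ← Fin.cons_self_tail β, h2, eq_of_step_eq_zero h0]
      have h2 : fusionWeight p t 1 0 (α 0) (β 0) = 1 - p ^ (-4 : ℤ) * t := by
        rw [eq_of_step_eq_zero h0]
        rcases Int.units_eq_one_or (β 0) with hb | hb <;> simp [hb, fusionWeight]
      simp only [h1, h2]
      split_ifs <;> simp [pow_succ']
    · rw [pathProd_eq_zero_of_le_of_lt (fusionWeight_down p t 1) (by omega) (by omega), mul_zero,
        if_neg]
      rintro rfl
      rw [ha] at hb; revert hb; decide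
    · rw [pathProd_eq_zero_of_lt_of_le (c := 0) (fusionWeight_up p t 1) (by omega) (by omega),
        mul_zero, if_neg]
      rintro rfl
      rw [ha] at hb; revert hb; decide

/-- The polynomial form of the six-vertex `L`-operator, evaluated. -/
def localEval (p t : ℂ) (a b : ℤˣ) : Matrix (Fin 2) (Fin 2) ℂ :=
  if a = 1 then
    if b = 1 then !![p ^ (-3 : ℤ) * t - p, 0; 0, p⁻¹ * t - p⁻¹]
    else !![0, 0; p ^ 2 - p ^ (-2 : ℤ), 0]
  else
    if b = 1 then !![0, (1 - p ^ (-4 : ℤ)) * t; 0, 0]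
    else !![p⁻¹ * t - p⁻¹, 0; 0, p ^ (-3 : ℤ) * t - p]

theorem localPoly_map_eval (N : ℕ) {p q : ℂ} (hp : p ≠ 0) (h1 : sqrtQ N q = p) (h2 : q = p ^ 2)
    (t : ℂ) (a b : ℤˣ) :
    (localPoly N q a b).map (Polynomial.evalRingHom t) = localEval p t a b := by
  have h : (1 : ℤˣ) ≠ -1 := by decide
  have h' : (-1 : ℤˣ) ≠ 1 := by decide
  subst h2
  rcases Int.units_eq_one_or a with rfl | rfl <;> rcases Int.units_eq_one_or b with rfl | rfl <;>
    ext i k <;> fin_cases i <;> fin_cases k <;>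
    simp [localPoly, localEval, qSigmaZ, sigmaPlus, sigmaMinus, h1, h, h',
      -mul_eq_mul_right_iff] <;> field_simp

theorem localEval_eq_zero (p t : ℂ) (a b : ℤˣ) (i k : Fin 2)
    (h : ((k : ℕ) : ℤ) + step a b ≠ (i : ℕ)) : localEval p t a b i k = 0 := by
  have h' : (-1 : ℤˣ) ≠ 1 := by decide
  rcases Int.units_eq_one_or a with rfl | rfl <;> rcases Int.units_eq_one_or b with rfl | rfl <;>
    fin_cases i <;> fin_cases k <;> simp [localEval, step, h', h'.symm] at h ⊢

/-- The invariant line of the tensor product, carrying the `j - 1` weights. Its total height `r`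
starts one above theirs, whence the shift by `-1`. -/
theorem fuseWeight_mulVec {p : ℂ} (hp : p ≠ 0) (t : ℂ) (j r : ℤ) (a b : ℤˣ) :
    (fuseWeight (fusionWeight p t j) (localEval p (p ^ (4 * j - 4) * t)) r a b).mulVec
        ![-p ^ (2 * (r + step a b)), 1] =
      (-(1 - p ^ (4 * j - 4) * t) * fusionWeight p t (j - 1) (r + -1) a b) •
        ![-p ^ (2 * r), 1] := by
  have h : (1 : ℤˣ) ≠ -1 := by decide
  have h' : (-1 : ℤˣ) ≠ 1 := by decide
  have hu : (Finset.univ : Finset ℤˣ) = {1, -1} := by decide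
  have hr : p ^ r ≠ 0 := zpow_ne_zero _ hp
  have hj : p ^ j ≠ 0 := zpow_ne_zero _ hp
  rcases Int.units_eq_one_or a with rfl | rfl <;> rcases Int.units_eq_one_or b with rfl | rfl <;>
    ext i <;> fin_cases i <;>
    simp [fuseWeight, fusionWeight, localEval, step, h, h', hu, Matrix.mulVec, dotProduct,
      Fin.sum_univ_two, zpow_add₀ hp, zpow_sub₀ hp, mul_add, mul_sub, zpow_mul' p, zpow_neg,
      zpow_ofNat, -mul_eq_mul_right_iff, -mul_eq_mul_left_iff] <;>
    field_simp <;> ring_nf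

/-- The covector `(1, p^(2r))` kills the invariant line spanned by `(-p^(2r), 1)`, so it sees the
quotient, which carries the `j + 1` weights. -/
theorem vecMul_fuseWeight {p : ℂ} (hp : p ≠ 0) (t : ℂ) (j r : ℤ) (a b : ℤˣ) :
    Matrix.vecMul ![1, p ^ (2 * r)]
        (fuseWeight (fusionWeight p t j) (localEval p (p ^ (4 * j - 4) * t)) r a b) =
      (-(1 - p ^ (4 * j - 8) * t) * fusionWeight p t (j + 1) (r + 0) a b) •
        ![1, p ^ (2 * (r + step a b))] := by
  have h : (1 : ℤˣ) ≠ -1 := by decide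
  have h' : (-1 : ℤˣ) ≠ 1 := by decide
  have hu : (Finset.univ : Finset ℤˣ) = {1, -1} := by decide
  have hr : p ^ r ≠ 0 := zpow_ne_zero _ hp
  have hj : p ^ j ≠ 0 := zpow_ne_zero _ hp
  rcases Int.units_eq_one_or a with rfl | rfl <;> rcases Int.units_eq_one_or b with rfl | rfl <;>
    ext i <;> fin_cases i <;>
    simp [fuseWeight, fusionWeight, localEval, step, h, h', hu, Matrix.vecMul, dotProduct,
      Fin.sum_univ_two, zpow_add₀ hp, zpow_sub₀ hp, mul_add, mul_sub, zpow_mul' p, zpow_neg,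
      zpow_ofNat, -mul_eq_mul_right_iff, -mul_eq_mul_left_iff] <;>
    field_simp <;> ring_nf

section Fuse

variable {p : ℂ} (t : ℂ) {L : ℕ} (α β : Fin L → ℤˣ)

theorem pathProd_fuseWeight_mulVec (hp : p ≠ 0) (hL : Even L) (hd : disp α β = 0) (j r : ℤ) :
    (pathProd (fuseWeight (fusionWeight p t j) (localEval p (p ^ (4 * j - 4) * t))) L r
        α β).mulVec ![-p ^ (2 * r), 1] =
      ((1 - p ^ (4 * j - 4) * t) ^ L * pathProd (fusionWeight p t (j - 1)) L (r + -1) α β) •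
        ![-p ^ (2 * r), 1] := by
  have h := pathProd_mulVec (v := fun r => ![-p ^ (2 * r), 1]) (fuseWeight_mulVec hp t j) L r α β
  rw [hd, add_zero, pathProd_mul_shift, hL.neg_pow] at h
  exact h

theorem vecMul_pathProd_fuseWeight (hp : p ≠ 0) (hL : Even L) (hd : disp α β = 0) (j r : ℤ) :
    Matrix.vecMul ![1, p ^ (2 * r)]
        (pathProd (fuseWeight (fusionWeight p t j) (localEval p (p ^ (4 * j - 4) * t))) L r α β) =
      ((1 - p ^ (4 * j - 8) * t) ^ L * pathProd (fusionWeight p t (j + 1)) L r α β) •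
        ![1, p ^ (2 * r)] := by
  have h := vecMul_pathProd (v := fun r => ![1, p ^ (2 * r)]) (vecMul_fuseWeight hp t j) L r α β
  rw [hd, add_zero, pathProd_mul_shift, hL.neg_pow, add_zero] at h
  exact h

theorem pathProd_fuseWeight_up (t' : ℂ) (hd : disp α β = 0) (j : ℤ) :
    pathProd (fuseWeight (fusionWeight p t j) (localEval p t')) L 0 α β 0 1 = 0 := by
  rw [← sum_pathProd_mul_pathProd _ _ (localEval_eq_zero p t') L 0 0]
  refine Finset.sum_eq_zero fun γ _ => ?_
  by_cases h : disp γ β = -1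
  · have := disp_add_disp α γ β
    rw [pathProd_eq_zero_of_lt_of_le (c := 0) (fusionWeight_up p t j) (by simp)
      (by simp; omega), zero_mul]
  · rw [pathProd_apply_eq_zero _ (localEval_eq_zero p t') _ (by simp; omega), mul_zero]

theorem pathProd_fuseWeight_down (t' : ℂ) (hd : disp α β = 0) (j : ℤ) :
    pathProd (fuseWeight (fusionWeight p t j) (localEval p t')) L j α β 1 0 = 0 := by
  rw [← sum_pathProd_mul_pathProd _ _ (localEval_eq_zero p t') L j 0]
  refine Finset.sum_eq_zero fun γ _ => ?_
  by_cases h : disp γ β = 1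
  · have := disp_add_disp α γ β
    rw [pathProd_eq_zero_of_le_of_lt (fusionWeight_down p t j) (by simp)
      (by simp; omega), zero_mul]
  · rw [pathProd_apply_eq_zero _ (localEval_eq_zero p t') _ (by simp; omega), mul_zero]

/-- A `2 × 2` matrix with the right eigenvector `(-x, 1)` and the left eigenvector `(1, x)`. -/
theorem fin_two_eigenvector_relations {G : Matrix (Fin 2) (Fin 2) ℂ} {x a b : ℂ}
    (h1 : G.mulVec ![-x, 1] = a • ![-x, 1]) (h2 : Matrix.vecMul ![1, x] G = b • ![1, x]) :
    G 1 1 = a + G 1 0 * x ∧ G 0 0 = b - G 1 0 * x ∧ x * G 0 0 - G 0 1 = a * x := by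
  have e0 := congrFun h1 0
  have e1 := congrFun h1 1
  have e2 := congrFun h2 0
  simp [Matrix.mulVec, Matrix.vecMul, dotProduct, Fin.sum_univ_two] at e0 e1 e2
  exact ⟨by linear_combination e1, by linear_combination e2, by linear_combination -e0⟩

/-- The product of the traces is the sum of the diagonal entries of the composite matrices `G r`.
For `1 ≤ r ≤ k` both entries occur, and their sum is the sum of the two eigenvalues; at `r = 0` and
`r = k + 1` one entry occurs, and a barrier makes it the `k + 2` eigenvalue alone. This gives `k`
terms of one kind and `k + 2` of the other. -/
theorem sum_fusionTrace_mul_trace (hp : p ≠ 0) (hL : Even L) (k : ℕ) :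
    ∑ γ, fusionTrace p t (k + 1) α γ *
        (pathProd (fun _ => localEval p (p ^ (4 * k) * t)) L 0 γ β).trace =
      (1 - p ^ (4 * k) * t) ^ L * fusionTrace p t k α β +
        (1 - p ^ (4 * (k : ℤ) - 4) * t) ^ L * fusionTrace p t (k + 2) α β := by
  by_cases hd : disp α β = 0
  swap
  · rw [fusionTrace, if_neg hd, fusionTrace, if_neg hd, mul_zero, mul_zero, add_zero]
    refine Finset.sum_eq_zero fun γ _ => ?_
    by_cases h : disp γ β = 0
    · have := disp_add_disp α γ β
      rw [fusionTrace, if_neg (by omega), zero_mul]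
    · rw [Matrix.trace_fin_two, pathProd_apply_eq_zero _ (localEval_eq_zero p _) _ (by simpa),
        pathProd_apply_eq_zero _ (localEval_eq_zero p _) _ (by simpa), add_zero, mul_zero]
  set t' := p ^ (4 * k) * t with ht'
  set w := fusionWeight p t ((k + 1 : ℕ) : ℤ) with hw
  set G := fun r : ℤ => pathProd (fuseWeight w (localEval p t')) L r α β with hG
  have hz : p ^ (4 * (((k + 1 : ℕ) : ℤ)) - 4) * t = t' := by
    rw [ht', ← zpow_natCast]; congr 2; push_cast; ring
  have hz' : 4 * (((k + 1 : ℕ) : ℤ)) - 8 = 4 * (k : ℤ) - 4 := by push_cast; ring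
  have key := fun r : ℤ => fin_two_eigenvector_relations
    (pathProd_fuseWeight_mulVec t α β hp hL hd ((k + 1 : ℕ) : ℤ) r)
    (vecMul_pathProd_fuseWeight t α β hp hL hd ((k + 1 : ℕ) : ℤ) r)
  simp only [hz, hz'] at key
  have hk1 : ((k + 1 : ℕ) : ℤ) - 1 = (k : ℤ) := by push_cast; ring
  have hk2 : ((k + 1 : ℕ) : ℤ) + 1 = ((k + 2 : ℕ) : ℤ) := by push_cast; ring
  rw [hk1, hk2] at key
  change ∀ r : ℤ, G r 1 1 = _ + G r 1 0 * _ ∧ G r 0 0 = _ - G r 1 0 * _ ∧ _ * G r 0 0 - G r 0 1 = _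
    at key
  have hup : G 0 0 1 = 0 := pathProd_fuseWeight_up t α β t' hd _
  have hdown : G ((k : ℤ) + 1) 1 0 = 0 := by
    have := pathProd_fuseWeight_down (p := p) t α β t' hd ((k + 1 : ℕ) : ℤ)
    push_cast at this
    simpa [hG, hw] using this
  have hL1 : ∑ γ, fusionTrace p t (k + 1) α γ *
        (pathProd (fun _ => localEval p t') L 0 γ β).trace =
      ∑ n ∈ Finset.range (k + 1), (G ((n : ℤ) + 1) 0 0 + G n 1 1) := by
    have : ∀ γ, fusionTrace p t (k + 1) α γ * (pathProd (fun _ => localEval p t') L 0 γ β).trace =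
        ∑ n ∈ Finset.range (k + 1),
          (pathProd w L ((n : ℤ) + 1 - 1 + ((0 : Fin 2) : ℕ)) α γ *
              pathProd (fun _ => localEval p t') L 0 γ β 0 0 +
            pathProd w L ((n : ℤ) - 1 + ((1 : Fin 2) : ℕ)) α γ *
              pathProd (fun _ => localEval p t') L 0 γ β 1 1) := by
      intro γ
      by_cases h : disp γ β = 0
      · have := disp_add_disp α γ β
        rw [fusionTrace, if_pos (by omega), Matrix.trace_fin_two, Finset.sum_mul]
        refine Finset.sum_congr rfl fun n _ => ?_
        simp [mul_add, hw]
      · rw [Matrix.trace_fin_two, pathProd_apply_eq_zero _ (localEval_eq_zero p _) _ (by simpa),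
          pathProd_apply_eq_zero _ (localEval_eq_zero p _) _ (by simpa)]
        simp
    rw [Finset.sum_congr rfl fun γ _ => this γ, Finset.sum_comm]
    refine Finset.sum_congr rfl fun n _ => ?_
    rw [Finset.sum_add_distrib, sum_pathProd_mul_pathProd _ _ (localEval_eq_zero p t'),
      sum_pathProd_mul_pathProd _ _ (localEval_eq_zero p t')]
  -- The unpaired boundary entries `G (k + 1) 0 0` and `G 0 1 1` are split off, leaving full traces
  -- at the interior heights.
  rw [hL1, Finset.sum_add_distrib, Finset.sum_range_succ (fun n : ℕ => G ((n : ℤ) + 1) 0 0),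
    Finset.sum_range_succ' (fun n : ℕ => G (n : ℤ) 1 1)]
  -- At `r = 0` the eigenvector is `(-1, 1)`; with `G 0 0 1 = 0` this makes `G 0 0 0` the eigenvalue
  -- on the line, so `G 0 1 1` is the other one.
  have h0 : G 0 1 1 =
      (1 - p ^ (4 * (k : ℤ) - 4) * t) ^ L * pathProd (fusionWeight p t (k + 2 : ℕ)) L 0 α β := by
    obtain ⟨e1, e2, e3⟩ := key 0
    rw [hup] at e3
    simp only [mul_zero, zpow_zero] at e1 e2 e3
    linear_combination e1 + e2 - e3
  have hj : G ((k : ℤ) + 1) 0 0 = (1 - p ^ (4 * (k : ℤ) - 4) * t) ^ L *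
      pathProd (fusionWeight p t (k + 2 : ℕ)) L ((k + 1 : ℕ) : ℤ) α β := by
    obtain ⟨e1, e2, e3⟩ := key ((k : ℤ) + 1)
    rw [hdown] at e2
    push_cast at e2 ⊢
    linear_combination e2
  have hm : ∀ n : ℕ, G ((n : ℤ) + 1) 0 0 + G ((n + 1 : ℕ) : ℤ) 1 1 =
      (1 - t') ^ L * pathProd (fusionWeight p t k) L n α β +
      (1 - p ^ (4 * (k : ℤ) - 4) * t) ^ L *
        pathProd (fusionWeight p t (k + 2 : ℕ)) L ((n + 1 : ℕ) : ℤ) α β := by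
    intro n
    obtain ⟨e1, e2, e3⟩ := key ((n : ℤ) + 1)
    rw [add_neg_cancel_right] at e1
    push_cast at e1 e2 ⊢
    linear_combination e1 + e2
  simp only [fusionTrace, hd, if_true]
  rw [Finset.sum_range_succ (n := k + 1), Finset.sum_range_succ' (n := k), Nat.cast_zero, h0, hj]
  have := Finset.sum_congr (s₁ := Finset.range k) rfl fun n _ => hm n
  rw [Finset.sum_add_distrib, Finset.sum_add_distrib, ← Finset.mul_sum, ← Finset.mul_sum] at this
  linear_combination this

end Fuse

/-! ### Roots of unity, the sector, and fusion as a polynomial identity -/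

theorem sqrtQ_sq {N : ℕ} (hN : Odd N) {q : ℂ} (hq : q ^ N = 1) : sqrtQ N q ^ 2 = q := by
  obtain ⟨m, rfl⟩ := hN
  rw [sqrtQ, ← pow_mul, show (2 * m + 1 + 1) / 2 * 2 = 2 * m + 1 + 1 by omega, pow_succ, hq, one_mul]

theorem sqrtQ_pow {N : ℕ} {q : ℂ} (hq : q ^ N = 1) : sqrtQ N q ^ N = 1 := by
  rw [sqrtQ, ← pow_mul, mul_comm, pow_mul, hq, one_pow]

theorem sqrtQ_ne_zero {N : ℕ} (hN : Odd N) {q : ℂ} (hq : q ^ N = 1) : sqrtQ N q ≠ 0 := by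
  intro h
  have := sqrtQ_pow hq
  rw [h, zero_pow hN.pos.ne'] at this
  exact zero_ne_one this

theorem dvd_disp {L N : ℕ} (hN : Odd N) (α β : Sector L N) : (N : ℤ) ∣ disp α.1 β.1 := by
  have h : IsCoprime (N : ℤ) 2 := by
    have := (Nat.coprime_two_right (n := N)).2 hN
    exact_mod_cast Nat.isCoprime_iff_coprime.2 this
  refine h.dvd_of_dvd_mul_left ?_
  rw [two_mul_disp]
  exact dvd_sub α.2 β.2

theorem sum_sector {R : Type*} [AddCommMonoid R] {L N : ℕ} (f : (Fin L → ℤˣ) → R)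
    (hf : ∀ γ, ¬ (N : ℤ) ∣ ∑ l, (γ l : ℤ) → f γ = 0) :
    ∑ γ : Sector L N, f γ.1 = ∑ γ, f γ := by
  rw [← Finset.sum_filter_of_ne (p := fun γ : Fin L → ℤˣ => (N : ℤ) ∣ ∑ l, (γ l : ℤ))
    fun γ _ h => not_not.1 fun h' => h (hf γ h')]
  exact (Finset.sum_subtype _ (by simp) f).symm

theorem hPow_ne_zero (L : ℕ) (c : ℂ) : hPow L c ≠ 0 := by
  refine pow_ne_zero _ fun h => ?_
  simpa using congrArg (Polynomial.eval 0) h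

theorem eval_hPow (L : ℕ) (c t : ℂ) : (hPow L c).eval t = (1 - c * t) ^ L := by
  simp [hPow]

theorem eval_rescale {ι : Type} (c t : ℂ) (M : Matrix ι ι ℂ[X]) (i k : ι) :
    (rescale c M i k).eval t = (M i k).eval (c * t) := by
  simp [rescale, eval_comp]

theorem eval_transferPoly (L N : ℕ) {p q : ℂ} (hp : p ≠ 0) (h1 : sqrtQ N q = p) (h2 : q = p ^ 2)
    (t : ℂ) (α β : Sector L N) :
    (transferPoly L N q α β).eval t =
      (pathProd (fun _ => localEval p t) L 0 α.1 β.1).trace := by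
  rw [transferPoly, ← pathProd_eq_ofFn _ _ 0]
  change Polynomial.evalRingHom t _ = _
  rw [AddMonoidHom.map_trace (Polynomial.evalRingHom t)]
  congr 1
  have := map_pathProd ((Polynomial.evalRingHom t).mapMatrix.toMonoidHom :
    Matrix (Fin 2) (Fin 2) ℂ[X] →* Matrix (Fin 2) (Fin 2) ℂ)
    (fun _ => localPoly N q) L 0 α.1 β.1
  have h3 : localEval p t = fun a b => (localPoly N q a b).map (Polynomial.evalRingHom t) := by
    ext1 a; ext1 b; exact (localPoly_map_eval N hp h1 h2 t a b).symm
  rw [h3]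
  exact this

theorem fusionTracePoly_mul_rescale_transferPoly {L N : ℕ} (hL : Even L) {p q : ℂ} (hp : p ≠ 0)
    (h1 : sqrtQ N q = p) (h2 : q = p ^ 2) (k : ℕ) :
    fusionTracePoly L N p (k + 1) * rescale ((q ^ 2) ^ k) (transferPoly L N q) =
      hPow L ((q ^ 2) ^ k) • fusionTracePoly L N p k +
        hPow L ((q ^ 2) ^ ((k : ℤ) - 1)) • fusionTracePoly L N p (k + 2) := by
  have hc : (q ^ 2) ^ k = p ^ (4 * k) := by rw [h2, ← pow_mul, ← pow_mul]; ring_nf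
  have hc' : (q ^ 2) ^ ((k : ℤ) - 1) = p ^ (4 * (k : ℤ) - 4) := by
    rw [h2, ← pow_mul, ← zpow_natCast p, ← zpow_mul]; congr 1; push_cast; ring
  rw [hc, hc']
  ext1 α β
  refine Polynomial.funext fun t => ?_
  simp only [Matrix.mul_apply, Matrix.add_apply, Matrix.smul_apply, smul_eq_mul, eval_finsetSum,
    eval_add, eval_mul, eval_hPow, eval_rescale, eval_fusionTracePoly,
    eval_transferPoly L N hp h1 h2]
  rw [← sum_fusionTrace_mul_trace t α.1 β.1 hp hL, ← sum_sector (N := N)]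
  intro γ hγ
  rw [Matrix.trace_fin_two]
  have : disp γ β.1 ≠ 0 := by
    intro h
    have := two_mul_disp γ β.1
    have h3 : ∑ l, (γ l : ℤ) = ∑ l, (β.1 l : ℤ) := by omega
    exact hγ (h3 ▸ β.2)
  rw [pathProd_apply_eq_zero _ (localEval_eq_zero p _) _ (by simpa),
    pathProd_apply_eq_zero _ (localEval_eq_zero p _) _ (by simpa), add_zero, mul_zero]

/-- The traces satisfy the same recursion and initial values, so by induction each division has a
numerator that is an exact multiple of the nonzero divisor. -/
theorem fusion_eq_fusionTracePoly {L N : ℕ} (hL : Even L) {p q : ℂ} (hp : p ≠ 0)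
    (h1 : sqrtQ N q = p) (h2 : q = p ^ 2) (j : ℕ) : fusion L N q j = fusionTracePoly L N p j := by
  induction j using Nat.strong_induction_on with
  | _ j ih =>
  match j with
  | 0 => ext1 α β; simp [fusion, fusionTracePoly]
  | 1 =>
    ext1 α β
    refine Polynomial.funext fun t => ?_
    rw [eval_fusionTracePoly, fusion]
    have hc : (q ^ 2)⁻¹ = p ^ (-4 : ℤ) := by
      rw [h2, ← pow_mul, zpow_neg]; rfl
    simp only [Matrix.smul_apply, smul_eq_mul, eval_mul, eval_hPow, hc, Matrix.one_apply]
    rw [fusionTrace]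
    split_ifs with ha hd hd
    · simpa [ha] using (pathProd_fusionWeight_one p t α.1 β.1 hd).symm
    · simp [ha, disp, step] at hd
    · have : α.1 ≠ β.1 := fun h => ha (Subtype.ext h)
      simp [pathProd_fusionWeight_one p t α.1 β.1 hd, this]
    · simp
  | j + 2 =>
    rw [fusion, ih j (by omega), ih (j + 1) (by omega),
      fusionTracePoly_mul_rescale_transferPoly hL hp h1 h2, add_sub_cancel_left]
    ext1 α β
    simp only [Matrix.map_apply, Matrix.smul_apply, smul_eq_mul]
    exact mul_div_cancel_left₀ _ (hPow_ne_zero _ _)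

theorem fusion_mul_rescale_transferPoly {L N : ℕ} (hL : Even L) (hN : Odd N) {q : ℂ}
    (hq : q ^ N = 1) (k : ℕ) :
    fusion L N q (k + 1) * rescale ((q ^ 2) ^ k) (transferPoly L N q) =
      hPow L ((q ^ 2) ^ k) • fusion L N q k +
        hPow L ((q ^ 2) ^ ((k : ℤ) - 1)) • fusion L N q (k + 2) := by
  simp only [fusion_eq_fusionTracePoly hL (sqrtQ_ne_zero hN hq) rfl (sqrtQ_sq hN hq).symm]
  exact fusionTracePoly_mul_rescale_transferPoly hL (sqrtQ_ne_zero hN hq) rfl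
    (sqrtQ_sq hN hq).symm k

theorem evalAt_fusion {L N : ℕ} (hL : Even L) (hN : Odd N) {q : ℂ} (hq : q ^ N = 1)
    (t : ℂ) (j : ℕ) (α β : Sector L N) :
    evalAt t (fusion L N q j) α β = fusionTrace (sqrtQ N q) t j α.1 β.1 := by
  rw [fusion_eq_fusionTracePoly hL (sqrtQ_ne_zero hN hq) rfl (sqrtQ_sq hN hq).symm,
    ← eval_fusionTracePoly]
  rfl

/-! ### Products of two Q-operators -/

/-- The local weight of the product of two `Q`-operators. -/
def pairWeight (p a b : ℂ) (j n : ℤ) (x y : ℤˣ) : ℂ :=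
  ∑ c : ℤˣ, p ^ ((c : ℤ) * (2 * n - j + 1 + step x y)) *
    ((if x ≠ c then a else 1) * (if c ≠ y then b else 1))

/-- The Fourier projector onto the sector. The offset `1 - j` is free because `p ^ N = 1` makes its
phase trivial when `N ∣ S`; it serves to align the heights with those of `fusionWeight`. -/
theorem sum_zpow_eq_ite {N : ℕ} {q p : ℂ} (hq : IsPrimitiveRoot q N)
    (h2 : q = p ^ 2) (hpN : p ^ N = 1) (hp : p ≠ 0) (j S : ℤ) :
    ∑ k ∈ Finset.range N, p ^ ((2 * (k : ℤ) - j + 1) * S) = if (N : ℤ) ∣ S then (N : ℂ) else 0 := by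
  have h : ∀ k : ℕ, p ^ ((2 * (k : ℤ) - j + 1) * S) = p ^ ((1 - j) * S) * (q ^ S) ^ k := by
    intro k
    rw [h2, ← zpow_natCast, ← zpow_natCast p, ← zpow_mul, ← zpow_mul, ← zpow_add₀ hp]
    congr 1; push_cast; ring
  simp only [h, ← Finset.mul_sum]
  split_ifs with hS
  · obtain ⟨m, rfl⟩ := hS
    have h3 : q ^ ((N : ℤ) * m) = 1 := by rw [zpow_mul, zpow_natCast, hq.pow_eq_one, one_zpow]
    have h4 : p ^ ((1 - j) * (N * m)) = 1 := by
      rw [mul_left_comm, zpow_mul, zpow_natCast, hpN, one_zpow]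
    simp [h3, h4]
  · have h3 : q ^ S ≠ 1 := fun h => hS ((hq.zpow_eq_one_iff_dvd S).1 h)
    have h4 : ∑ k ∈ Finset.range N, (q ^ S) ^ k = 0 := by
      rw [geom_sum_eq h3, ← zpow_natCast, ← zpow_mul, mul_comm, zpow_mul, zpow_natCast,
        hq.pow_eq_one, one_zpow, sub_self, zero_div]
    rw [h4, mul_zero]

/-- The quadratic form in the exponent of `Q`. -/
def orderedPairing {L : ℕ} (α β : Fin L → ℤˣ) : ℤ :=
  ∑ l, (α l : ℤ) * ∑ m ∈ Finset.univ.filter (fun m => m < l), (β m : ℤ)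

/-- When one configuration lies in the sector the right side is divisible by `N`, so the arguments
of the pairing can be swapped in exponents of an `N`-th root of unity. -/
theorem orderedPairing_add_swap {L : ℕ} (α β : Fin L → ℤˣ) :
    orderedPairing α β + orderedPairing β α + ∑ l, (α l : ℤ) * (β l : ℤ) =
      (∑ l, (α l : ℤ)) * ∑ l, (β l : ℤ) := by
  have h : orderedPairing β α =
      ∑ l, (α l : ℤ) * ∑ m ∈ Finset.univ.filter (fun m => l < m), (β m : ℤ) := by
    simp only [orderedPairing, Finset.sum_filter, Finset.mul_sum]
    rw [Finset.sum_comm]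
    refine Finset.sum_congr rfl fun l _ => Finset.sum_congr rfl fun m _ => ?_
    split_ifs <;> ring
  rw [h, orderedPairing, ← Finset.sum_add_distrib, ← Finset.sum_add_distrib, Finset.sum_mul]
  refine Finset.sum_congr rfl fun l _ => ?_
  rw [← mul_add, ← mul_add]
  congr 1
  have : (β l : ℤ) = ∑ m, if m = l then (β m : ℤ) else 0 := by simp
  rw [this, Finset.sum_filter, Finset.sum_filter, ← Finset.sum_add_distrib,
    ← Finset.sum_add_distrib]
  refine Finset.sum_congr rfl fun m _ => ?_
  rcases lt_trichotomy m l with h | h | h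
  · simp [h, h.ne, h.not_gt]
  · simp [h]
  · simp [h, h.ne', h.not_gt]

theorem even_sum_mul {L : ℕ} (hL : Even L) (α β : Fin L → ℤˣ) :
    2 * ((∑ l, (α l : ℤ) * (β l : ℤ)) / 2) = ∑ l, (α l : ℤ) * (β l : ℤ) := by
  refine Int.mul_ediv_cancel' ?_
  have h : ∀ x y : ℤˣ, (2 : ℤ) ∣ (x : ℤ) * y - 1 := by decide
  have h1 : (2 : ℤ) ∣ ∑ l, ((α l : ℤ) * (β l : ℤ) - 1) := Finset.dvd_sum fun l _ => h _ _
  rw [Finset.sum_sub_distrib] at h1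
  have h2 : (2 : ℤ) ∣ ∑ l : Fin L, (1 : ℤ) := by
    simpa using (Int.natCast_dvd_natCast (m := 2)).2 hL.two_dvd
  simpa using dvd_add h1 h2

/-- The entries of `Q` in terms of a square root `r` of `q ^ (1 / 2)`. -/
theorem Qop_apply {L N : ℕ} (hL : Even L) {q r : ℂ} (hr : r ≠ 0) (h : sqrtQ N q = r ^ 2) (s : ℂ)
    (α β : Sector L N) :
    Qop L N q s α β =
      r ^ (-2 * orderedPairing α.1 β.1 - ∑ l, (α.1 l : ℤ) * (β.1 l : ℤ)) *
        ∏ l, if α.1 l ≠ β.1 l then s else 1 := by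
  rw [Qop, h, Finset.prod_ite, Finset.prod_const, Finset.prod_const_one, mul_one]
  congr 1
  rw [← zpow_natCast r, ← zpow_mul, ← zpow_mul, ← zpow_add₀ hr, orderedPairing]
  congr 1
  have := even_sum_mul hL α.1 β.1
  push_cast
  linear_combination -this

theorem prod_zpow {ι : Type*} {r : ℂ} (hr : r ≠ 0) (s : Finset ι) (f : ι → ℤ) :
    ∏ l ∈ s, r ^ f l = r ^ ∑ l ∈ s, f l := by
  induction s using Finset.cons_induction with
  | empty => simp
  | cons a s ha ih => rw [Finset.prod_cons, Finset.sum_cons, ih, zpow_add₀ hr]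

theorem smul_Qop_mul_Qop_apply {L N : ℕ} (hL : Even L) (hN : Odd N) {q : ℂ}
    (hq : IsPrimitiveRoot q N) (a b : ℂ) (j : ℤ) (α β : Sector L N) :
    (N : ℂ) * (Qop L N q a * Qop L N q b) α β =
      ∑ k ∈ Finset.range N, pathProd (pairWeight (sqrtQ N q) a b j) L k α.1 β.1 := by
  set p := sqrtQ N q with hp
  have hpN : p ^ N = 1 := sqrtQ_pow hq.pow_eq_one
  have hp0 : p ≠ 0 := sqrtQ_ne_zero hN hq.pow_eq_one
  have hp2 : p ^ 2 = q := sqrtQ_sq hN hq.pow_eq_one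
  -- `r ^ 4 = q` and `r ^ N = 1`: the quarter powers of `q` become integer powers of an `N`-th root
  -- of unity.
  set r := sqrtQ N p with hr
  have hrN : r ^ N = 1 := sqrtQ_pow hpN
  have hr0 : r ≠ 0 := sqrtQ_ne_zero hN hpN
  have hr2 : r ^ 2 = p := sqrtQ_sq hN hpN
  set f := fun γ : Fin L → ℤˣ =>
    r ^ (-2 * orderedPairing α.1 γ - ∑ l, (α.1 l : ℤ) * (γ l : ℤ)) *
      (∏ l, if α.1 l ≠ γ l then a else 1) *
    (r ^ (-2 * orderedPairing γ β.1 - ∑ l, (γ l : ℤ) * (β.1 l : ℤ)) *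
      ∏ l, if γ l ≠ β.1 l then b else 1) with hf
  have h1 : (N : ℂ) * (Qop L N q a * Qop L N q b) α β =
      ∑ γ : Fin L → ℤˣ, (if (N : ℤ) ∣ ∑ l, (γ l : ℤ) then (N : ℂ) else 0) * f γ := by
    rw [Matrix.mul_apply, Finset.mul_sum, ← sum_sector (N := N)]
    · refine Finset.sum_congr rfl fun γ _ => ?_
      rw [if_pos γ.2, Qop_apply hL hr0 hr2.symm, Qop_apply hL hr0 hr2.symm]
    · intro γ hγ
      rw [if_neg hγ, zero_mul]
  have h2 : ∀ k : ℤ, pathProd (pairWeight p a b j) L k α.1 β.1 =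
      ∑ γ : Fin L → ℤˣ, p ^ ((2 * k - j + 1) * ∑ l, (γ l : ℤ)) * f γ := by
    intro k
    rw [pathProd_eq_prod]
    simp only [pairWeight]
    rw [Finset.prod_univ_sum, Fintype.piFinset_univ]
    refine Finset.sum_congr rfl fun γ _ => ?_
    rw [Finset.prod_mul_distrib, Finset.prod_mul_distrib, prod_zpow hp0, hf]
    have : p ^ (∑ l, (γ l : ℤ) * (2 * (k + ∑ m ∈ Finset.univ.filter (fun m => m < l),
        step (α.1 m) (β.1 m)) - j + 1 + step (α.1 l) (β.1 l))) =
        p ^ ((2 * k - j + 1) * ∑ l, (γ l : ℤ)) *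
        (r ^ (-2 * orderedPairing α.1 γ - ∑ l, (α.1 l : ℤ) * (γ l : ℤ)) *
        r ^ (-2 * orderedPairing γ β.1 - ∑ l, (γ l : ℤ) * (β.1 l : ℤ))) := by
      -- Swapping the pairing of `α` and `γ` puts `γ` on the left in both factors. The exponent is
      -- then linear in each `γ l`, with a coefficient given by the current height, so the sum over
      -- `γ` factorizes over sites.
      obtain ⟨m, hm⟩ := α.2
      have hN1 : r ^ ((N : ℤ) * (2 * m * ∑ l, (γ l : ℤ))) = 1 := by
        rw [zpow_mul, zpow_natCast, hrN, one_zpow]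
      rw [← mul_one (r ^ _ * r ^ _), ← hN1, ← hr2, ← zpow_natCast r, ← zpow_mul, ← zpow_mul,
        ← zpow_add₀ hr0, ← zpow_add₀ hr0, ← zpow_add₀ hr0]
      congr 1
      have e1 := orderedPairing_add_swap γ α.1
      rw [hm] at e1
      have e2 : ∑ l, (γ l : ℤ) * (2 * (k + ∑ m ∈ Finset.univ.filter (fun m => m < l),
          step (α.1 m) (β.1 m)) - j + 1 + step (α.1 l) (β.1 l)) * 2 =
          2 * (2 * k - j + 1) * ∑ l, (γ l : ℤ) + 2 * orderedPairing γ α.1 -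
            2 * orderedPairing γ β.1 + ∑ l, (γ l : ℤ) * (α.1 l : ℤ) -
            ∑ l, (γ l : ℤ) * (β.1 l : ℤ) := by
        trans ∑ l, (2 * (2 * k - j + 1) * (γ l : ℤ) +
          2 * ((γ l : ℤ) * ∑ m ∈ Finset.univ.filter (fun m => m < l), (α.1 m : ℤ)) -
          2 * ((γ l : ℤ) * ∑ m ∈ Finset.univ.filter (fun m => m < l), (β.1 m : ℤ)) +
          (γ l : ℤ) * (α.1 l : ℤ) - (γ l : ℤ) * (β.1 l : ℤ))
        swap
        · simp only [Finset.sum_add_distrib, Finset.sum_sub_distrib, ← Finset.mul_sum,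
            orderedPairing]
        refine Finset.sum_congr rfl fun l _ => ?_
        have e3 := two_mul_step (α.1 l) (β.1 l)
        have e4 : 2 * ∑ m ∈ Finset.univ.filter (fun m => m < l), step (α.1 m) (β.1 m) =
            ∑ m ∈ Finset.univ.filter (fun m => m < l), (α.1 m : ℤ) -
            ∑ m ∈ Finset.univ.filter (fun m => m < l), (β.1 m : ℤ) := by
          rw [Finset.mul_sum, ← Finset.sum_sub_distrib]
          exact Finset.sum_congr rfl fun m _ => two_mul_step _ _
        linear_combination (γ l : ℤ) * e3 + 2 * (γ l : ℤ) * e4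
      have e5 : ∑ l, (α.1 l : ℤ) * (γ l : ℤ) = ∑ l, (γ l : ℤ) * (α.1 l : ℤ) := by
        simp only [mul_comm]
      rw [← Finset.sum_mul] at e2
      push_cast
      linear_combination e2 + 2 * e1 + e5
    rw [this]
    ring
  rw [h1, Finset.sum_congr rfl fun k _ => h2 _, Finset.sum_comm]
  refine Finset.sum_congr rfl fun γ _ => ?_
  rw [← Finset.sum_mul, sum_zpow_eq_ite hq hp2.symm hpN hp0]

theorem pairWeight_flat {p : ℂ} (hp : p ≠ 0) (s : ℂ) (j n : ℤ) (x : ℤˣ) :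
    pairWeight p (p ^ (-2 : ℤ) * s) (-(p ^ (2 * j - 2) * s)) j n x x =
      fusionWeight p (p ^ 2 * s ^ 2) j n x x := by
  have h : (1 : ℤˣ) ≠ -1 := by decide
  have h' : (-1 : ℤˣ) ≠ 1 := by decide
  have hr : p ^ n ≠ 0 := zpow_ne_zero _ hp
  have hj : p ^ j ≠ 0 := zpow_ne_zero _ hp
  rcases Int.units_eq_one_or x with rfl | rfl <;>
    simp [pairWeight, fusionWeight, step, h, h', zpow_add₀ hp, zpow_sub₀ hp, mul_add, mul_sub,
      zpow_mul' p, zpow_neg, zpow_ofNat] <;> field_simp <;> ring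

/-- Only the product over the edge agrees: `pairWeight` has a factor `s` in each direction, whereas
`fusionWeight` has the whole `s²` on the way down. -/
theorem pairWeight_edge {p : ℂ} (hp : p ≠ 0) (s : ℂ) (j n : ℤ) :
    pairWeight p (p ^ (-2 : ℤ) * s) (-(p ^ (2 * j - 2) * s)) j n 1 (-1) *
      pairWeight p (p ^ (-2 : ℤ) * s) (-(p ^ (2 * j - 2) * s)) j (n + 1) (-1) 1 =
    fusionWeight p (p ^ 2 * s ^ 2) j n 1 (-1) *
      fusionWeight p (p ^ 2 * s ^ 2) j (n + 1) (-1) 1 := by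
  have h : (1 : ℤˣ) ≠ -1 := by decide
  have h' : (-1 : ℤˣ) ≠ 1 := by decide
  have hr : p ^ n ≠ 0 := zpow_ne_zero _ hp
  have hj : p ^ j ≠ 0 := zpow_ne_zero _ hp
  simp [pairWeight, fusionWeight, step, h, h', zpow_add₀ hp, zpow_sub₀ hp, mul_add,
      mul_sub, zpow_mul' p, zpow_neg, zpow_ofNat]
  field_simp
  ring

theorem pairWeight_up {p : ℂ} (hp : p ≠ 0) (s : ℂ) (j : ℤ) :
    pairWeight p (p ^ (-2 : ℤ) * s) (-(p ^ (2 * j - 2) * s)) j (-1) 1 (-1) = 0 := by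
  have h : (1 : ℤˣ) ≠ -1 := by decide
  have hj : p ^ j ≠ 0 := zpow_ne_zero _ hp
  simp [pairWeight, step, h, zpow_add₀ hp, zpow_sub₀ hp, mul_add,
      mul_sub, zpow_mul' p, zpow_neg, zpow_ofNat]
  field_simp
  ring

theorem pairWeight_down {p : ℂ} (hp : p ≠ 0) (s : ℂ) (j : ℤ) :
    pairWeight p (p ^ (-2 : ℤ) * s) (-(p ^ (2 * j - 2) * s)) j j (-1) 1 = 0 := by
  have h : (1 : ℤˣ) ≠ -1 := by decide
  have h' : (-1 : ℤˣ) ≠ 1 := by decide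
  have hj : p ^ j ≠ 0 := zpow_ne_zero _ hp
  simp [pairWeight, step, h, h', zpow_sub₀ hp, mul_sub, zpow_mul' p, zpow_neg, zpow_ofNat]
  field_simp
  ring

theorem pairWeight_add_mul {p : ℂ} (hp : p ≠ 0) {N : ℕ} (hpN : p ^ N = 1) (a b : ℂ) (j n m : ℤ)
    (x y : ℤˣ) : pairWeight p a b j (n + N * m) x y = pairWeight p a b j n x y := by
  refine Finset.sum_congr rfl fun c _ => ?_
  congr 1
  rw [show (c : ℤ) * (2 * (n + N * m) - j + 1 + step x y) =
    (c : ℤ) * (2 * n - j + 1 + step x y) + N * (c * 2 * m) by ring, zpow_add₀ hp,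
    zpow_mul p N, zpow_natCast, hpN, one_zpow, mul_one]

/-- Modulo the period `N` the complement of `[0, j)` is a block of length `N - j` starting at `j`;
with the edge identity below, its weights are gauge equivalent to the fusion weights of that length.
-/
theorem fusionWeight_flat_complement {p : ℂ} (hp : p ≠ 0) {N : ℕ} (hpN : p ^ N = 1) (t : ℂ)
    (j n : ℤ) (x : ℤˣ) :
    fusionWeight p t j n x x = fusionWeight p (p ^ (4 * j) * t) (N - j) (n + -j) x x := by
  have h' : (-1 : ℤˣ) ≠ 1 := by decide
  have hr : p ^ n ≠ 0 := zpow_ne_zero _ hp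
  have hj : p ^ j ≠ 0 := zpow_ne_zero _ hp
  rcases Int.units_eq_one_or x with rfl | rfl <;>
    simp [fusionWeight, h', zpow_add₀ hp, zpow_sub₀ hp, mul_add, hpN,
      mul_sub, zpow_mul' p, zpow_neg, zpow_ofNat] <;> field_simp

theorem fusionWeight_edge_complement {p : ℂ} (hp : p ≠ 0) {N : ℕ} (hpN : p ^ N = 1) (t : ℂ)
    (j n : ℤ) :
    fusionWeight p t j n 1 (-1) * fusionWeight p t j (n + 1) (-1) 1 =
      fusionWeight p (p ^ (4 * j) * t) (N - j) (n + -j) 1 (-1) *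
        fusionWeight p (p ^ (4 * j) * t) (N - j) (n + 1 + -j) (-1) 1 := by
  have h' : (-1 : ℤˣ) ≠ 1 := by decide
  have hr : p ^ n ≠ 0 := zpow_ne_zero _ hp
  have hj : p ^ j ≠ 0 := zpow_ne_zero _ hp
  simp [fusionWeight, h', zpow_add₀ hp, zpow_sub₀ hp, mul_add, hpN,
      mul_sub, zpow_mul' p, zpow_neg, zpow_ofNat]
  field_simp
  ring

theorem smul_Qop_mul_Qop {L N : ℕ} (hL : Even L) (hN : Odd N) {q : ℂ} (hq : IsPrimitiveRoot q N)
    {j : ℕ} (hj : j ≤ N) (s : ℂ) :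
    (N : ℂ) • (Qop L N q (q⁻¹ * s) * Qop L N q (-(q ^ ((j : ℤ) - 1) * s))) =
      evalAt (q * s ^ 2) (fusion L N q j) +
        evalAt ((q ^ 2) ^ j * (q * s ^ 2)) (fusion L N q (N - j)) := by
  ext1 α β
  rw [Matrix.add_apply, evalAt_fusion hL hN hq.pow_eq_one, evalAt_fusion hL hN hq.pow_eq_one,
    Matrix.smul_apply, smul_eq_mul, smul_Qop_mul_Qop_apply hL hN hq _ _ j]
  have hpN := sqrtQ_pow hq.pow_eq_one
  have hp := sqrtQ_ne_zero hN hq.pow_eq_one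
  have hp2 := sqrtQ_sq hN hq.pow_eq_one
  generalize sqrtQ N q = p at *
  have e1 : q⁻¹ = p ^ (-2 : ℤ) := by rw [← hp2, zpow_neg]; rfl
  have e2 : q ^ ((j : ℤ) - 1) = p ^ (2 * (j : ℤ) - 2) := by
    rw [← hp2, ← zpow_natCast p, ← zpow_mul]; congr 1; push_cast; ring
  have e3 : (q ^ 2) ^ j = p ^ (4 * (j : ℤ)) := by
    rw [← hp2, ← zpow_natCast, ← zpow_natCast, ← zpow_natCast p, ← zpow_mul, ← zpow_mul]
    congr 1; push_cast; ring
  rw [e1, e2, e3, ← hp2]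
  set w := pairWeight p (p ^ (-2 : ℤ) * s) (-(p ^ (2 * (j : ℤ) - 2) * s)) j with hw
  by_cases hd : disp α.1 β.1 = 0
  · rw [fusionTrace, fusionTrace, if_pos hd, if_pos hd]
    have h1 : ∀ k : ℤ, pathProd w L k α.1 β.1 =
        pathProd (fusionWeight p (p ^ 2 * s ^ 2) j) L k α.1 β.1 := fun k =>
      pathProd_congr_of_disp_eq_zero (fun n x => pairWeight_flat hp s j n x)
        (fun n => pairWeight_edge hp s j n) k hd
    have h2 : ∀ k : ℤ, pathProd (fusionWeight p (p ^ 2 * s ^ 2) j) L k α.1 β.1 =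
        pathProd (fusionWeight p (p ^ (4 * (j : ℤ)) * (p ^ 2 * s ^ 2)) (N - j)) L (k + -j)
          α.1 β.1 := by
      intro k
      have h3 := pathProd_mul_shift 1 (-(j : ℤ))
        (fusionWeight p (p ^ (4 * (j : ℤ)) * (p ^ 2 * s ^ 2)) (N - j)) L k α.1 β.1
      rw [one_pow, one_mul] at h3
      rw [← h3]
      simp only [one_mul]
      exact pathProd_congr_of_disp_eq_zero (fun n x => fusionWeight_flat_complement hp hpN _ j n x)
        (fun n => fusionWeight_edge_complement hp hpN _ j n) k hd
    obtain ⟨m, rfl⟩ := Nat.exists_eq_add_of_le hj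
    -- The `N` starting heights split into the block `[0, j)` and the block `[j, N)`, re-based at 0.
    rw [Finset.sum_range_add, Nat.add_sub_cancel_left]
    congr 1
    · exact Finset.sum_congr rfl fun k _ => h1 k
    · refine Finset.sum_congr rfl fun k _ => ?_
      rw [h1, h2]
      congr 1
      · congr 1; push_cast; ring
      · push_cast; ring
  · rw [fusionTrace, fusionTrace, if_neg hd, if_neg hd, add_zero]
    refine Finset.sum_eq_zero fun k hk => ?_
    have hk := Finset.mem_range.1 hk
    have hdvd := dvd_disp hN α β
    -- A nonzero displacement within the sector is a multiple of `N`, so the path winds around the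
    -- cycle and meets a barrier or one of its translates by `N`.
    rcases lt_or_gt_of_ne hd with h | h
    · have h1 : (N : ℤ) ≤ -disp α.1 β.1 := Int.le_of_dvd (by omega) (by simpa using hdvd)
      by_cases hkj : j ≤ k
      · exact pathProd_eq_zero_of_le_of_lt (c := j) (pairWeight_down hp s j) (by omega) (by omega)
      · refine pathProd_eq_zero_of_le_of_lt (c := j + N * (-1)) ?_ (by omega) (by omega)
        rw [hw, pairWeight_add_mul hp hpN]
        exact pairWeight_down hp s j
    · have h1 : (N : ℤ) ≤ disp α.1 β.1 := Int.le_of_dvd h hdvd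
      refine pathProd_eq_zero_of_lt_of_le (c := N) ?_ (by omega) (by omega)
      rw [show (N : ℤ) - 1 = -1 + N * 1 by ring, hw, pairWeight_add_mul hp hpN]
      exact pairWeight_up hp s j

/-! ### Noncommutative algebra: commutation, TQ-relation, Wronskian -/

section FusionAlgebra

variable {A : Type*} [Ring A] [Algebra ℂ A] {h : ℤ → ℂ} {τ : ℤ → A} {T : ℤ → ℕ → A}

theorem fusion_two (hh : ∀ m, h m ≠ 0) (T0 : ∀ i, T i 0 = 0) (T1 : ∀ i, T i 1 = h (i + 1) • 1)
    (hT : ∀ (i : ℤ) (d : ℕ) (m : ℤ), m = i + d + 1 →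
      T i (d + 1) * τ m = h (m + 1) • T i d + h m • T i (d + 2))
    (m : ℤ) : T (m - 1) 2 = τ m := by
  have h1 := hT (m - 1) 0 m (by simp)
  rw [T1, T0, smul_zero, zero_add, sub_add_cancel, smul_mul_assoc, one_mul] at h1
  exact (smul_right_injective A (hh m) h1).symm

/-- The fusion relation with the two-dimensional representation on the left. -/
theorem left_fusion (hh : ∀ m, h m ≠ 0) (T0 : ∀ i, T i 0 = 0) (T1 : ∀ i, T i 1 = h (i + 1) • 1)
    (hT : ∀ (i : ℤ) (d : ℕ) (m : ℤ), m = i + d + 1 →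
      T i (d + 1) * τ m = h (m + 1) • T i d + h m • T i (d + 2))
    (m : ℤ) (d : ℕ) :
    τ m * T m (d + 1) = h (m + 1) • T (m - 1) (d + 2) + h m • T (m + 1) d := by
  induction d using Nat.twoStepInduction with
  | zero => rw [T1, T0, fusion_two hh T0 T1 hT, mul_smul_comm, mul_one, smul_zero, add_zero]
  | one =>
    have h1 := hT (m - 1) 1 (m + 1) (by simp)
    have h2 := fusion_two hh T0 T1 hT (m + 1)
    rw [add_sub_cancel_right] at h2
    rw [fusion_two hh T0 T1 hT, ← h2, T1, sub_add_cancel] at h1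
    rw [T1, h1]
    module
  | more d h1 h2 =>
    have r1 := hT m (d + 1) (m + d + 2) (by push_cast; ring)
    have r2 := hT (m - 1) (d + 2) (m + d + 2) (by push_cast; ring)
    have r3 := hT (m + 1) d (m + d + 2) (by ring)
    have e := congrArg (fun x => τ m * x) r1
    simp only [mul_add, mul_smul_comm, ← mul_assoc, h1] at e
    rw [h2, add_mul, smul_mul_assoc, smul_mul_assoc, r2, r3] at e
    -- Multiplying `T m (d + 2)` by `τ` on both sides and expanding in the two possible orders gives
    -- the claim times `h (m + d + 2)`.
    refine smul_right_injective A (hh (m + d + 2)) ?_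
    simp only
    linear_combination (norm := module) -e

variable {N : ℕ} {Q R : ℤ → A}

/-- The relation for `Q i * R (i + d)` and the one for `R (i + d) * Q (i + N)` have the same two
terms on the right in opposite order, and `Q` has period `N`. -/
theorem pair_commute (hN : 0 < N) (TN : ∀ i, T (i + N) = T i) (QN : ∀ i c, Q (i + N * c) = Q i)
    (hQR : ∀ (i : ℤ) (d : ℕ), d ≤ N →
      (N : ℂ) • (Q i * R (i + d)) = T i d + T (i + d) (N - d))
    (hRQ : ∀ (i : ℤ) (d : ℕ), d ≤ N →
      (N : ℂ) • (R i * Q (i + d)) = T i d + T (i + d) (N - d)) (i m : ℤ) :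
    Commute (Q i) (R m) := by
  have hN' : (N : ℂ) ≠ 0 := Nat.cast_ne_zero.2 hN.ne'
  have key : ∀ (i : ℤ) (d : ℕ), d ≤ N → Commute (Q i) (R (i + d)) := by
    intro i d hd
    refine smul_right_injective A hN' ?_
    have h2 := hRQ (i + d) (N - d) (by omega)
    rw [show i + d + ((N - d : ℕ) : ℤ) = i + N by omega, TN, show N - (N - d) = d by omega,
      ← mul_one (N : ℤ), QN] at h2
    simp only
    rw [hQR i d hd, h2, add_comm]
  have h1 : (m - i) = N * ((m - i) / N) + (m - i) % N := (Int.mul_ediv_add_emod _ _).symm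
  have h2 := Int.emod_nonneg (m - i) (by omega : (N : ℤ) ≠ 0)
  have h3 := Int.emod_lt_of_pos (m - i) (by omega : 0 < (N : ℤ))
  rw [← QN i ((m - i) / N)]
  have h4 := key (i + N * ((m - i) / N)) ((m - i) % N).toNat (by omega)
  rwa [Int.toNat_of_nonneg h2, show i + N * ((m - i) / N) + (m - i) % N = m by omega] at h4

theorem adjacent_commute (hN : 0 < N) (TN : ∀ i, T (i + N) = T i)
    (QN : ∀ i c, Q (i + N * c) = Q i) (RN : ∀ i, R (i + N) = R i)
    (hQR : ∀ (i : ℤ) (d : ℕ), d ≤ N →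
      (N : ℂ) • (Q i * R (i + d)) = T i d + T (i + d) (N - d))
    (hRQ : ∀ (i : ℤ) (d : ℕ), d ≤ N →
      (N : ℂ) • (R i * Q (i + d)) = T i d + T (i + d) (N - d))
    (hR : ∀ i, IsUnit (R i)) (i : ℤ) : Commute (Q i) (Q (i + 1)) := by
  have hN' : (N : ℂ) ≠ 0 := Nat.cast_ne_zero.2 hN.ne'
  have hc := pair_commute hN TN QN hQR hRQ
  -- The relations with `d = 1` at `i` and `d = N - 1` at `i + 1` have the same right side.
  have h1 : Q i * R (i + 1) = Q (i + 1) * R i := by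
    refine smul_right_injective A hN' ?_
    have e1 := hQR i 1 hN
    have e2 := hQR (i + 1) (N - 1) (by omega)
    rw [show i + 1 + ((N - 1 : ℕ) : ℤ) = i + N by omega, RN, TN, show N - (N - 1) = 1 by omega] at e2
    simp only
    rw [e2, ← Nat.cast_one, e1, add_comm]
  refine (hR i).mul_left_injective ?_
  calc Q i * Q (i + 1) * R i = Q i * (Q i * R (i + 1)) := by rw [mul_assoc, h1]
    _ = Q i * R (i + 1) * Q i := by rw [mul_assoc, (hc i (i + 1)).eq]
    _ = Q (i + 1) * Q i * R i := by rw [h1, mul_assoc, mul_assoc, (hc i i).eq]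

/-- The `TQ`-relation. -/
theorem mul_eq_of_pair_relations (hN : 2 ≤ N) (hh : ∀ m, h m ≠ 0) (T0 : ∀ i, T i 0 = 0)
    (T1 : ∀ i, T i 1 = h (i + 1) • 1)
    (hT : ∀ (i : ℤ) (d : ℕ) (m : ℤ), m = i + d + 1 →
      T i (d + 1) * τ m = h (m + 1) • T i d + h m • T i (d + 2))
    (TN : ∀ i, T (i + N) = T i) (QN : ∀ i c, Q (i + N * c) = Q i)
    (hQR : ∀ (i : ℤ) (d : ℕ), d ≤ N →
      (N : ℂ) • (Q i * R (i + d)) = T i d + T (i + d) (N - d))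
    (hRQ : ∀ (i : ℤ) (d : ℕ), d ≤ N →
      (N : ℂ) • (R i * Q (i + d)) = T i d + T (i + d) (N - d))
    (hR : ∀ i, IsUnit (R i)) (m : ℤ) :
    τ m * Q m = h m • Q (m + 1) + h (m + 1) • Q (m - 1) := by
  have hN' : (N : ℂ) ≠ 0 := Nat.cast_ne_zero.2 (by omega)
  have hc := pair_commute (by omega) TN QN hQR hRQ
  obtain ⟨M, rfl⟩ := Nat.exists_eq_add_of_le' hN
  refine (hR (m - 1)).mul_left_injective (smul_right_injective A hN' ?_)
  -- `R (m - 1)` times `Q (m - 1)`, `Q m` and `Q (m + 1)` are read off from `d = 0, 1, 2`. Left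
  -- fusion applied to `τ m` times the middle one yields the other two; then `R (m - 1)` is
  -- cancelled.
  have e0 := hRQ (m - 1) 0 (by omega)
  have e1 := hRQ (m - 1) 1 (by omega)
  have e2 := hRQ (m - 1) 2 (by omega)
  rw [Nat.cast_zero, add_zero, T0, zero_add, Nat.sub_zero] at e0
  rw [Nat.cast_one, sub_add_cancel, T1, sub_add_cancel, show M + 2 - 1 = M + 1 by omega] at e1
  rw [Nat.cast_two, show m - 1 + 2 = m + 1 by ring, Nat.add_sub_cancel,
    fusion_two hh T0 T1 hT] at e2
  have e3 := left_fusion hh T0 T1 hT m M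
  have e4 := congrArg (fun x => τ m * x) e1
  simp only [mul_add, mul_smul_comm, mul_one, e3] at e4
  simp only [add_mul, smul_mul_assoc, mul_assoc, (hc _ (m - 1)).eq]
  linear_combination (norm := module) e4 - h m • e2 - h (m + 1) • e0

/-- The fusion recursion in `d` and the TQ-relation are second-order recursions with the same
coefficients, so their Casoratian is determined by its value at `d = 0`. -/
theorem wronskian (hh : ∀ m, h m ≠ 0) (T0 : ∀ i, T i 0 = 0)
    (T1 : ∀ i, T i 1 = h (i + 1) • 1)
    (hT : ∀ (i : ℤ) (d : ℕ) (m : ℤ), m = i + d + 1 →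
      T i (d + 1) * τ m = h (m + 1) • T i d + h m • T i (d + 2))
    (hTQ : ∀ m, τ m * Q m = h m • Q (m + 1) + h (m + 1) • Q (m - 1)) (d : ℕ) :
    T 0 (d + 1) * Q d - T 0 d * Q (d + 1) = h (d + 1) • Q 0 := by
  induction d with
  | zero => simp [T1, T0]
  | succ d ih =>
    refine smul_right_injective A (hh (d + 1)) ?_
    have e1 := congrArg (fun x => x * Q (d + 1)) (hT 0 d (d + 1) (by ring))
    have e2 := congrArg (fun x => T 0 (d + 1) * x) (hTQ (d + 1))
    have e3 := congrArg (fun x => h (d + 1 + 1) • x) ih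
    simp only [add_mul, mul_add, smul_mul_assoc, mul_smul_comm, mul_assoc,
      add_sub_cancel_right] at e1 e2
    simp only [Nat.cast_add, Nat.cast_one] at e3 ⊢
    linear_combination (norm := module) e2 - e1 + e3

end FusionAlgebra

/-! ### Generic invertibility and continuity in the spectral parameter -/

open Filter

theorem evalAt_mul {ι : Type} [Fintype ι] (t : ℂ) (M M' : Matrix ι ι ℂ[X]) :
    evalAt t (M * M') = evalAt t M * evalAt t M' :=
  Matrix.map_mul (f := Polynomial.evalRingHom t)

theorem evalAt_add {ι : Type} (t : ℂ) (M M' : Matrix ι ι ℂ[X]) :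
    evalAt t (M + M') = evalAt t M + evalAt t M' := by
  ext; simp [evalAt]

theorem evalAt_hPow_smul {ι : Type} (L : ℕ) (c t : ℂ) (M : Matrix ι ι ℂ[X]) :
    evalAt t (hPow L c • M) = (1 - c * t) ^ L • evalAt t M := by
  ext; simp [evalAt, eval_hPow]

theorem evalAt_rescale {ι : Type} (c t : ℂ) (M : Matrix ι ι ℂ[X]) :
    evalAt t (rescale c M) = evalAt (c * t) M := by
  ext; simp [evalAt, eval_rescale]

theorem continuous_evalAt {ι : Type} {f : ℂ → ℂ} (hf : Continuous f) (M : Matrix ι ι ℂ[X]) :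
    Continuous fun s => evalAt (f s) M := by
  refine continuous_matrix fun i k => ?_
  simp only [evalAt, Matrix.map_apply]
  exact (M i k).continuous.comp hf

theorem continuous_Qop {L N : ℕ} (q : ℂ) {f : ℂ → ℂ} (hf : Continuous f) :
    Continuous fun s => Qop L N q (f s) := by
  refine continuous_matrix fun α β => ?_
  simp only [Qop]
  fun_prop

/-- At `s = 0` only the diagonal survives, with exponent `-(∑ α)²` of an `N`-th root of unity, which
is trivial on the sector. -/
theorem Qop_zero {L N : ℕ} (hL : Even L) (hN : Odd N) {q : ℂ} (hq : q ^ N = 1) :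
    Qop L N q 0 = 1 := by
  have hpN := sqrtQ_pow hq
  have hp0 := sqrtQ_ne_zero hN hq
  have hr2 := sqrtQ_sq hN hpN
  have hrN := sqrtQ_pow hpN
  have hr0 := sqrtQ_ne_zero hN hpN
  ext α β
  rw [Qop_apply hL hr0 hr2.symm, Matrix.one_apply]
  split_ifs with h
  · subst h
    obtain ⟨m, hm⟩ := α.2
    have h1 := orderedPairing_add_swap α.1 α.1
    rw [show -2 * orderedPairing α.1 α.1 - ∑ l, (α.1 l : ℤ) * (α.1 l : ℤ) =
      N * (-m * ∑ l, (α.1 l : ℤ)) by rw [hm] at h1 ⊢; linear_combination -h1, zpow_mul,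
      zpow_natCast, hrN]
    simp
  · obtain ⟨l, hl⟩ : ∃ l, α.1 l ≠ β.1 l := by
      by_contra h'
      exact h (Subtype.ext (funext fun l => not_not.1 fun h2 => h' ⟨l, h2⟩))
    rw [Finset.prod_eq_zero (Finset.mem_univ l) (by simp [hl]), mul_zero]

theorem eventually_cofinite_eval_ne_zero {P : ℂ[X]} (hP : P ≠ 0) :
    ∀ᶠ s in cofinite, P.eval s ≠ 0 := by
  rw [eventually_cofinite]
  simpa using Polynomial.finite_setOfPred_isRoot hP

/-- The determinant is a polynomial in `s` with value 1 at `s = 0`, so it has finitely many zeros.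
-/
theorem eventually_isUnit_Qop {L N : ℕ} (hL : Even L) (hN : Odd N) {q : ℂ} (hq : q ^ N = 1) :
    ∀ᶠ s in cofinite, IsUnit (Qop L N q s) := by
  let P : Matrix (Sector L N) (Sector L N) ℂ[X] := fun α β =>
    C (Qop L N q 1 α β) * X ^ (Finset.univ.filter fun ℓ => α.1 ℓ ≠ β.1 ℓ).card
  have hP : ∀ s, P.det.eval s = (Qop L N q s).det := by
    intro s
    have h := RingHom.map_det (Polynomial.evalRingHom s) P
    rw [coe_evalRingHom] at h
    rw [h]
    congr 1
    ext α β
    change (P α β).eval s = _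
    simp [P, Qop]
  have h0 : P.det ≠ 0 := by
    intro h
    have := hP 0
    rw [h, Qop_zero hL hN hq] at this
    simp at this
  filter_upwards [eventually_cofinite_eval_ne_zero h0] with s hs
  rw [Matrix.isUnit_iff_isUnit_det, isUnit_iff_ne_zero, ← hP]
  exact hs

theorem eq_of_eventually_cofinite_eq {E : Type*} [TopologicalSpace E] [T2Space E] {f g : ℂ → E}
    (hf : Continuous f) (hg : Continuous g) (h : ∀ᶠ s in cofinite, f s = g s) : f = g := by
  refine Continuous.ext_on (s := {s | f s = g s}) ?_ hf hg fun s hs => hs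
  have h1 := (eventually_cofinite.1 h).countable.dense_compl ℝ
  simpa [Set.compl_ofPred] using h1

theorem zpow_emod_natCast {N : ℕ} {q : ℂ} (hq0 : q ≠ 0) (hq : q ^ N = 1) (m : ℤ) :
    q ^ (m % N) = q ^ m := by
  conv_rhs => rw [← Int.emod_add_mul_ediv m N]
  rw [zpow_add₀ hq0, zpow_mul, zpow_natCast, hq, one_zpow, mul_one]

theorem forall_zpow_of_forall_pow {N : ℕ} (hN : 0 < N) {q : ℂ} (hq0 : q ≠ 0) (hq : q ^ N = 1)
    {P : ℂ → Prop} (h : ∀ k < N, P (q ^ k)) (m : ℤ) : P (q ^ m) := by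
  have h2 := Int.emod_nonneg m (by omega : (N : ℤ) ≠ 0)
  have h3 := Int.emod_lt_of_pos m (by omega : 0 < (N : ℤ))
  have := h (m % N).toNat (by omega)
  rwa [← zpow_natCast, Int.toNat_of_nonneg h2, zpow_emod_natCast hq0 hq] at this

theorem eventually_forall_zpow {N : ℕ} (hN : 0 < N) {q : ℂ} (hq0 : q ≠ 0) (hq : q ^ N = 1)
    {P : ℂ → ℂ → Prop} (h : ∀ c, c ≠ 0 → ∀ᶠ s in cofinite, P c s) :
    ∀ᶠ s in cofinite, ∀ m : ℤ, P (q ^ m) s := by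
  have h1 : ∀ᶠ s in cofinite, ∀ k ∈ Finset.range N, P (q ^ k) s :=
    (Finset.range N).eventually_all.2 fun k _ => h _ (pow_ne_zero _ hq0)
  filter_upwards [h1] with s hs
  exact forall_zpow_of_forall_pow hN hq0 hq (P := fun c => P c s)
    fun k hk => hs k (Finset.mem_range.2 hk)

theorem eventually_comp_mul {P : ℂ → Prop} (h : ∀ᶠ s in cofinite, P s) {c : ℂ} (hc : c ≠ 0) :
    ∀ᶠ s in cofinite, P (c * s) :=
  (mul_right_injective₀ hc).tendsto_cofinite.eventually h

/-! ### The functional relation for Q -/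

section Sector

variable {L N : ℕ} {q : ℂ}

theorem smul_Qop_zpow_mul_Qop (hL : Even L) (hN : Odd N) (hq : IsPrimitiveRoot q N) (s : ℂ)
    (i : ℤ) (d : ℕ) (hd : d ≤ N) :
    (N : ℂ) • (Qop L N q (q ^ i * s) * Qop L N q (-(q ^ (i + d) * s))) =
      evalAt ((q ^ 2) ^ (i + 1) * (q * s ^ 2)) (fusion L N q d) +
        evalAt ((q ^ 2) ^ (i + d + 1) * (q * s ^ 2)) (fusion L N q (N - d)) := by
  have hq0 : q ≠ 0 := hq.ne_zero hN.pos.ne'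
  have hq2 : q ^ 2 ≠ 0 := pow_ne_zero _ hq0
  have h := smul_Qop_mul_Qop hL hN hq hd (q ^ (i + 1) * s)
  have e1 : q⁻¹ * (q ^ (i + 1) * s) = q ^ i * s := by
    rw [zpow_add_one₀ hq0]; field_simp
  have e2 : q ^ ((d : ℤ) - 1) * (q ^ (i + 1) * s) = q ^ (i + d) * s := by
    rw [← mul_assoc, ← zpow_add₀ hq0]; congr 2; ring
  have e3 : q * (q ^ (i + 1) * s) ^ 2 = (q ^ 2) ^ (i + 1) * (q * s ^ 2) := by
    rw [← zpow_natCast q 2, ← zpow_mul, mul_comm _ (i + 1), zpow_mul, zpow_natCast]; ring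
  rw [e1, e2, e3, ← mul_assoc ((q ^ 2) ^ d), ← zpow_natCast (q ^ 2) d, ← zpow_add₀ hq2,
    show (d : ℤ) + (i + 1) = i + d + 1 by ring] at h
  exact h

theorem evalAt_fusion_mul_transferPoly (hL : Even L) (hN : Odd N) (hq : IsPrimitiveRoot q N)
    (t : ℂ) (i : ℤ) (d : ℕ) (m : ℤ) (hm : m = i + d + 1) :
    evalAt ((q ^ 2) ^ (i + 1) * t) (fusion L N q (d + 1)) *
        evalAt ((q ^ 2) ^ m * t) (transferPoly L N q) =
      (1 - (q ^ 2) ^ (m + 1 - 1) * t) ^ L • evalAt ((q ^ 2) ^ (i + 1) * t) (fusion L N q d) +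
        (1 - (q ^ 2) ^ (m - 1) * t) ^ L •
          evalAt ((q ^ 2) ^ (i + 1) * t) (fusion L N q (d + 2)) := by
  have hq2 : q ^ 2 ≠ 0 := pow_ne_zero _ (hq.ne_zero hN.pos.ne')
  have h := congrArg (evalAt ((q ^ 2) ^ (i + 1) * t))
    (fusion_mul_rescale_transferPoly hL hN hq.pow_eq_one d)
  rw [evalAt_mul, evalAt_add, evalAt_hPow_smul, evalAt_hPow_smul, evalAt_rescale, ← mul_assoc,
    ← mul_assoc, ← zpow_natCast (q ^ 2) d, ← zpow_add₀ hq2, ← zpow_add₀ hq2] at h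
  rw [hm, show i + d + 1 + 1 - 1 = (d : ℤ) + (i + 1) by ring,
    show i + d + 1 - 1 = (d : ℤ) - 1 + (i + 1) by ring, show i + d + 1 = (d : ℤ) + (i + 1) by ring]
  exact h

theorem evalAt_fusion_one (hN : Odd N) (hq : IsPrimitiveRoot q N) (t : ℂ) (i : ℤ) :
    evalAt ((q ^ 2) ^ (i + 1) * t) (fusion L N q 1) =
      (1 - (q ^ 2) ^ (i + 1 - 1) * t) ^ L • 1 := by
  have hq2 : q ^ 2 ≠ 0 := pow_ne_zero _ (hq.ne_zero hN.pos.ne')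
  rw [fusion, evalAt_hPow_smul, ← mul_assoc, zpow_sub_one₀ hq2, mul_comm (q ^ 2)⁻¹]
  congr 1
  ext α β
  by_cases h : α = β <;> simp [evalAt, Matrix.one_apply, h]

theorem evalAt_fusion_zero (t : ℂ) : evalAt t (fusion L N q 0) = 0 := by
  ext; simp [fusion, evalAt]

/-- The algebra cancels `Q(-q^i s)` and the factors `h`, legitimate outside finitely many `s`; both
identities are continuous in `s`, hence hold everywhere. -/
theorem commute_Qop_and_wronskian (hL : Even L) (hN : Odd N) (hq : IsPrimitiveRoot q N)
    (d : ℕ) (hd : d < N) (s : ℂ) :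
    Qop L N q (q ^ d * s) * Qop L N q (q ^ (d + 1) * s) =
        Qop L N q (q ^ (d + 1) * s) * Qop L N q (q ^ d * s) ∧
      evalAt (q ^ 2 * (q * s ^ 2)) (fusion L N q (d + 1)) * Qop L N q (q ^ d * s) -
          evalAt (q ^ 2 * (q * s ^ 2)) (fusion L N q d) * Qop L N q (q ^ (d + 1) * s) =
        (1 - (q ^ 2) ^ d * (q * s ^ 2)) ^ L • Qop L N q s := by
  have hq0 : q ≠ 0 := hq.ne_zero hN.pos.ne'
  have hq2 : q ^ 2 ≠ 0 := pow_ne_zero _ hq0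
  have hq2N : (q ^ 2) ^ N = 1 := by rw [← pow_mul, mul_comm, pow_mul, hq.pow_eq_one, one_pow]
  have hgen : ∀ᶠ s in cofinite,
      Qop L N q (q ^ d * s) * Qop L N q (q ^ (d + 1) * s) =
        Qop L N q (q ^ (d + 1) * s) * Qop L N q (q ^ d * s) ∧
      evalAt (q ^ 2 * (q * s ^ 2)) (fusion L N q (d + 1)) * Qop L N q (q ^ d * s) -
          evalAt (q ^ 2 * (q * s ^ 2)) (fusion L N q d) * Qop L N q (q ^ (d + 1) * s) =
        (1 - (q ^ 2) ^ d * (q * s ^ 2)) ^ L • Qop L N q s := by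
    have hu := eventually_isUnit_Qop hL hN hq.pow_eq_one
    have hu2 := eventually_forall_zpow hN.pos hq0 hq.pow_eq_one
      (P := fun c s => IsUnit (Qop L N q (-(c * s)))) fun c hc => by
        have := eventually_comp_mul hu (neg_ne_zero.2 hc)
        simpa only [neg_mul] using this
    have hu3 := eventually_forall_zpow hN.pos hq2 hq2N
      (P := fun c s => 1 - c * (q * s ^ 2) ≠ 0) fun c hc => by
        have h1 : (1 - C (c * q) * X ^ 2 : ℂ[X]) ≠ 0 := fun h => by
          simpa using congrArg (Polynomial.eval 0) h
        filter_upwards [eventually_cofinite_eval_ne_zero h1] with s hs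
        simpa [mul_assoc] using hs
    filter_upwards [hu2, hu3] with s hR hh
    have T0 : ∀ i : ℤ, evalAt ((q ^ 2) ^ (i + 1) * (q * s ^ 2)) (fusion L N q 0) = 0 :=
      fun i => evalAt_fusion_zero _
    have T1 := evalAt_fusion_one (L := L) hN hq (q * s ^ 2)
    have hT := evalAt_fusion_mul_transferPoly hL hN hq (q * s ^ 2)
    have hh' : ∀ m : ℤ, (1 - (q ^ 2) ^ (m - 1) * (q * s ^ 2)) ^ L ≠ 0 := fun m =>
      pow_ne_zero _ (hh _)
    have hQR := smul_Qop_zpow_mul_Qop hL hN hq s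
    -- The right side depends on `s²` only, so `s ↦ -s` exchanges the roles of `Q` and `R`.
    have hRQ := smul_Qop_zpow_mul_Qop hL hN hq (-s)
    simp only [mul_neg, neg_neg, neg_sq] at hRQ
    have TN : ∀ i : ℤ, (fun d => evalAt ((q ^ 2) ^ (i + N + 1) * (q * s ^ 2)) (fusion L N q d)) =
        fun d => evalAt ((q ^ 2) ^ (i + 1) * (q * s ^ 2)) (fusion L N q d) := by
      intro i
      rw [add_right_comm, zpow_add₀ hq2, zpow_natCast, hq2N, mul_one]
    have QN : ∀ i c : ℤ, q ^ (i + N * c) = q ^ i := fun i c => by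
      rw [zpow_add₀ hq0, zpow_mul, zpow_natCast, hq.pow_eq_one, one_zpow, mul_one]
    constructor
    · have := adjacent_commute (Q := fun i : ℤ => Qop L N q (q ^ i * s))
        (R := fun i : ℤ => Qop L N q (-(q ^ i * s)))
        (T := fun i d => evalAt ((q ^ 2) ^ (i + 1) * (q * s ^ 2)) (fusion L N q d)) hN.pos TN
        (fun i c => by rw [QN]) (fun i => by have := QN i 1; rw [mul_one] at this; rw [this])
        hQR hRQ hR d
      exact_mod_cast this.eq
    -- The TQ-relation needs `N ≥ 2`, which follows from `0 < d < N`; the case `d = 0` needs only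
    -- the initial values, so `N = 1` is covered.
    · rcases Nat.eq_zero_or_pos d with rfl | hd0
      · have h1 := T1 0
        rw [zero_add, zpow_one, sub_self, zpow_zero] at h1
        simp [evalAt_fusion_zero, h1]
      · have hTQ := mul_eq_of_pair_relations (Q := fun i : ℤ => Qop L N q (q ^ i * s))
          (R := fun i : ℤ => Qop L N q (-(q ^ i * s)))
          (T := fun i d => evalAt ((q ^ 2) ^ (i + 1) * (q * s ^ 2)) (fusion L N q d))
          (h := fun m => (1 - (q ^ 2) ^ (m - 1) * (q * s ^ 2)) ^ L)
          (τ := fun m => evalAt ((q ^ 2) ^ m * (q * s ^ 2)) (transferPoly L N q))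
          (by omega) hh' T0 T1 hT TN (fun i c => by rw [QN]) hQR hRQ hR
        have := wronskian (Q := fun i : ℤ => Qop L N q (q ^ i * s))
          (T := fun i d => evalAt ((q ^ 2) ^ (i + 1) * (q * s ^ 2)) (fusion L N q d))
          (h := fun m => (1 - (q ^ 2) ^ (m - 1) * (q * s ^ 2)) ^ L)
          (τ := fun m => evalAt ((q ^ 2) ^ m * (q * s ^ 2)) (transferPoly L N q))
          hh' T0 T1 hT hTQ d
        simp only [zero_add, zpow_one, zpow_zero, one_mul, add_sub_cancel_right] at this
        exact_mod_cast this
  have cQ : ∀ c : ℂ, Continuous fun s => Qop L N q (c * s) := fun c =>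
    continuous_Qop q (by fun_prop)
  have cQ1 : Continuous fun s => Qop L N q s := continuous_Qop q continuous_id
  have cT : ∀ d, Continuous fun s => evalAt (q ^ 2 * (q * s ^ 2)) (fusion L N q d) := fun d =>
    continuous_evalAt (by fun_prop) _
  have c1 : Continuous fun s : ℂ => (1 - (q ^ 2) ^ d * (q * s ^ 2)) ^ L := by fun_prop
  exact ⟨congrFun (eq_of_eventually_cofinite_eq ((cQ _).mul (cQ _)) ((cQ _).mul (cQ _))
      (hgen.mono fun s hs => hs.1)) s,
    congrFun (eq_of_eventually_cofinite_eq
      (((cT _).mul (cQ _)).sub ((cT _).mul (cQ _))) (c1.smul cQ1)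
      (hgen.mono fun s hs => hs.2)) s⟩

theorem smul_Qop_neg_eq (hL : Even L) (hN : Odd N) (hq : IsPrimitiveRoot q N) (s : ℂ)
    (hs : ∀ k : ℕ, k < N → IsUnit (Qop L N q (q ^ k * s))) :
    (N : ℂ) • Qop L N q (-s) =
      Qop L N q s * ∑ k ∈ Finset.range N, (1 - (q ^ 2) ^ ((k : ℤ) - 1) * (q * s ^ 2)) ^ L •
        ((Qop L N q (q ^ ((k : ℤ) - 1) * s))⁻¹ * (Qop L N q (q ^ k * s))⁻¹) := by
  have hq0 : q ≠ 0 := hq.ne_zero hN.pos.ne'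
  have hq2 : q ^ 2 ≠ 0 := pow_ne_zero _ hq0
  have hu : ∀ m : ℤ, IsUnit (Qop L N q (q ^ m * s)) :=
    forall_zpow_of_forall_pow hN.pos hq0 hq.pow_eq_one (P := fun c => IsUnit (Qop L N q (c * s))) hs
  have hu' : ∀ m : ℤ, IsUnit (Qop L N q (q ^ m * s)).det := fun m =>
    (Matrix.isUnit_iff_isUnit_det _).1 (hu m)
  set f := fun k : ℤ => (1 - (q ^ 2) ^ (k - 1) * (q * s ^ 2)) ^ L •
    ((Qop L N q (q ^ (k - 1) * s))⁻¹ * (Qop L N q (q ^ k * s))⁻¹) with hf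
  -- The Wronskian identity times `Q(q^d s)⁻¹ Q(q^(d+1) s)⁻¹` is the difference of consecutive left
  -- sides, because neighbouring `Q`s commute.
  have hsum : ∀ d : ℕ, d ≤ N → evalAt (q ^ 2 * (q * s ^ 2)) (fusion L N q d) *
      (Qop L N q (q ^ (d : ℤ) * s))⁻¹ =
      Qop L N q s * ∑ k ∈ Finset.range d, f ((k + 1 : ℕ) : ℤ) := by
    intro d hd
    induction d with
    | zero => simp [evalAt_fusion_zero]
    | succ d ih =>
      obtain ⟨hc, hw⟩ := commute_Qop_and_wronskian hL hN hq d (by omega) s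
      rw [Finset.sum_range_succ, mul_add, ← ih (by omega), hf]
      simp only [Nat.cast_add, Nat.cast_one, add_sub_cancel_right, zpow_natCast]
      have hd1 := hu' d
      have hd2 := hu' (d + 1)
      have e1 : (q : ℂ) ^ ((d : ℤ) + 1) = q ^ (d + 1) := by exact_mod_cast zpow_natCast q (d + 1)
      rw [zpow_natCast] at hd1
      rw [e1] at hd2 ⊢
      clear ih
      generalize evalAt (q ^ 2 * (q * s ^ 2)) (fusion L N q d) = T₁ at *
      generalize evalAt (q ^ 2 * (q * s ^ 2)) (fusion L N q (d + 1)) = T₂ at *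
      generalize Qop L N q (q ^ d * s) = Q₁ at *
      generalize Qop L N q (q ^ (d + 1) * s) = Q₂ at *
      rw [mul_smul_comm, ← mul_assoc (Qop L N q s), ← smul_mul_assoc, ← smul_mul_assoc, ← hw, sub_mul, sub_mul,
        mul_assoc _ Q₁, Matrix.mul_nonsing_inv _ hd1, mul_one]
      have e2 : Q₂ * Q₁⁻¹ * Q₂⁻¹ = Q₁⁻¹ := by
        have : Q₂ * Q₁⁻¹ = Q₁⁻¹ * Q₂ := by
          calc Q₂ * Q₁⁻¹ = Q₁⁻¹ * (Q₁ * Q₂) * Q₁⁻¹ := by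
                rw [← mul_assoc, Matrix.nonsing_inv_mul _ hd1, one_mul]
            _ = Q₁⁻¹ * Q₂ := by
                rw [hc, mul_assoc, mul_assoc, Matrix.mul_nonsing_inv _ hd1, mul_one]
        rw [this, mul_assoc, Matrix.mul_nonsing_inv _ hd2, mul_one]
      rw [mul_assoc (_ * Q₂), mul_assoc _ Q₂, ← mul_assoc Q₂, e2]
      abel
  have hfN : f (N : ℤ) = f 0 := by
    have h1 : q ^ (N : ℤ) = 1 := by rw [zpow_natCast, hq.pow_eq_one]
    have h2 : (q ^ 2) ^ (N : ℤ) = 1 := by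
      rw [zpow_natCast, ← pow_mul, mul_comm, pow_mul, hq.pow_eq_one, one_pow]
    simp only [hf, zpow_sub_one₀ hq0, zpow_sub_one₀ hq2, h1, h2, zpow_zero]
  -- Telescoping produces the terms `1, …, N`; periodicity replaces `N` by 0.
  have hshift : ∑ k ∈ Finset.range N, f ((k + 1 : ℕ) : ℤ) = ∑ k ∈ Finset.range N, f (k : ℤ) := by
    have h1 := Finset.sum_range_succ (fun k : ℕ => f (k : ℤ)) N
    rw [Finset.sum_range_succ', Nat.cast_zero, hfN] at h1
    exact add_right_cancel h1
  have hT := smul_Qop_zpow_mul_Qop hL hN hq s 0 N le_rfl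
  -- At `-s` the QQ-relation with `j = N` reads `N Q(-s) Q(s) = T^{(N)}(ω t)`, with `Q(s)` on the
  -- right, where `Q(s)⁻¹` cancels it.
  have hT' := smul_Qop_zpow_mul_Qop hL hN hq (-s) 0 N le_rfl
  have e0 : q ^ ((0 : ℤ) + N) = 1 := by rw [zero_add, zpow_natCast, hq.pow_eq_one]
  rw [e0, Nat.sub_self, evalAt_fusion_zero, add_zero, zpow_zero, zero_add, zpow_one, one_mul]
    at hT hT'
  rw [neg_neg, neg_sq] at hT'
  have h1 := hsum N le_rfl
  have hu0 := hu' 0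
  rw [zpow_zero, one_mul] at hu0
  rw [hshift, zpow_natCast, hq.pow_eq_one, one_mul, ← hT', smul_mul_assoc, mul_assoc,
    Matrix.mul_nonsing_inv _ hu0, mul_one] at h1
  rw [h1]
  simp only [hf, zpow_natCast]

end Sector

end
end SixVertex

theorem mainTheorem1 (L N : ℕ) (hL : Even L) (hN : Odd N) (q : ℂ) (hq : IsPrimitiveRoot q N) :
    -- the divisions defining the fusion matrices are exact: the fusion relations hold
    (∀ j : ℕ, 1 ≤ j →
      SixVertex.fusion L N q j *
          SixVertex.rescale ((q ^ 2) ^ (j - 1)) (SixVertex.transferPoly L N q) =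
        SixVertex.hPow L ((q ^ 2) ^ (j - 1)) • SixVertex.fusion L N q (j - 1) +
          SixVertex.hPow L ((q ^ 2) ^ ((j : ℤ) - 2)) • SixVertex.fusion L N q (j + 1)) ∧
    -- the `QQ`-relations, with `t = q s²` and `ω = q²`
    (∀ j : ℕ, j ≤ N → ∀ s : ℂ,
      (N : ℂ) • (SixVertex.Qop L N q (q⁻¹ * s) *
          SixVertex.Qop L N q (-(q ^ ((j : ℤ) - 1) * s))) =
        SixVertex.evalAt (q * s ^ 2) (SixVertex.fusion L N q j) +
          SixVertex.evalAt ((q ^ 2) ^ j * (q * s ^ 2)) (SixVertex.fusion L N q (N - j))) ∧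
    -- `Q(s)` is invertible for all but finitely many `s`
    {s : ℂ | ¬ IsUnit (SixVertex.Qop L N q s)}.Finite ∧
    -- the `Q`-functional relation
    (∀ s : ℂ, (∀ k : ℕ, k < N → IsUnit (SixVertex.Qop L N q (q ^ k * s))) →
      (N : ℂ) • SixVertex.Qop L N q (-s) =
        SixVertex.Qop L N q s *
          ∑ k ∈ Finset.range N,
            (1 - (q ^ 2) ^ ((k : ℤ) - 1) * (q * s ^ 2)) ^ L •
              ((SixVertex.Qop L N q (q ^ ((k : ℤ) - 1) * s))⁻¹ *
                (SixVertex.Qop L N q (q ^ k * s))⁻¹)) := by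
  refine ⟨fun j hj => ?_, fun j hj s => SixVertex.smul_Qop_mul_Qop hL hN hq hj s,
    Filter.eventually_cofinite.1 (SixVertex.eventually_isUnit_Qop hL hN hq.pow_eq_one),
    fun s hs => SixVertex.smul_Qop_neg_eq hL hN hq s hs⟩
  obtain ⟨k, rfl⟩ := Nat.exists_eq_add_of_le' hj
  rw [Nat.add_sub_cancel, show ((k + 1 : ℕ) : ℤ) - 2 = (k : ℤ) - 1 by push_cast; ring]
  exact SixVertex.fusion_mul_rescale_transferPoly hL hN hq.pow_eq_one k
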